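/- Let $R$ be a commutative ring. A Hermitian algebra over $R$ (with trivial conjugation on $R$) is a unital, not necessarily commutative $R$-algebra $A$ with an $R$-linear map $\star\colon A\to A$ such that $(ab)^\star=b^\star a^\star$ and $(a^\star)^\star=a$, and a symmetric $R$-bilinear form $\mathfrak t$ on $A$ such that $\mathfrak t(ba,c)=\mathfrak t(a,b^\star c)=\mathfrak t(b,ca^\star)$ for all $a,b,c\in A$ and such that for every $n\ge 1$ the map $A^{\otimes_R n}\to (A^{\otimes_R n})^*=\mathrm{Hom}_R(A^{\otimes_R n},R)$, $a_1\otimes\cdots\otimes a_n\mapsto\big(a_1'\otimes\cdots\otimes a_n'\mapsto\prod_i\mathfrak t(a_i',a_i)\big)$, is injective. Let $A$ be a Hermitian algebra, let $\boxtimes$ denote the tensor product over $A$, and let $M$ be a free $A$–$A$-bimodule (on which $R$ acts centrally) with a finite preferred basis $\mathcal B$ of elements that are homogeneous with degrees in $\mathbb Z/2\mu\mathbb Z$, $\mu\ge 0$. Let $\mathcal A=T_A(M)=\bigoplus_{n\ge0}M^{\boxtimes n}$, graded with $M^{\boxtimes 0}=A$ in degree $0$, and let $\partial\colon\mathcal A\to\mathcal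 A$ be an $A$–$A$-bimodule map of degree $-1$ with $\partial^2=0$ and $\partial(xy)=\partial(x)y+(-1)^{|x|}x\,\partial(y)$ for homogeneous $x$. Write $\partial|_M=\sum_n\partial_n$ with $\partial_n\colon M\to M^{\boxtimes n}$. An augmentation is a unital, degree-preserving $R$-algebra map $\varepsilon\colon\mathcal A\to A$ ($A$ in degree $0$) with $\varepsilon|_{A}=\mathrm{id}_A$ and $\varepsilon\circ\partial=0$. For each $n\ge 0$, let $\langle\cdot,\cdot\rangle$ be the $R$-bilinear pairing on $M^{\boxtimes n}$ with $$\langle a_0d_1a_1\cdots d_na_n,\;a_0'd_1'a_1'\cdots d_n'a_n'\rangle=\begin{cases}\prod_{i=0}^n\mathfrak t(a_i,a_i')&\text{if }d_i=d_i'\text{ for all }i,\\0&\text{otherwise,}\end{cases}\qquad a_i,a_i'\in A,\ d_i,d_i'\in\mathcal B.$$ For an $R$-linear map $f\colon M\to M^{\boxtimes n}$, we say that the adjoint $f^*\colon(M^{\boxtimes n})^*\to M^*$ (duals over $R$) restricts to $\nu\colon M^{\boxtimes n}\to M$ if $f^*(\langle w,\cdot\rangle)=\langle\nu(w),\cdot\rangle$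 in $M^*$ for all $w\in M^{\boxtimes n}$. 1. For every $n\ge1$, the adjoint $(\partial_n)^*$ restricts to a unique $A$–$A$-bimodule map $\mu_n\colon M^{\boxtimes n}\to M$. 2. For every $n\ge1$ and every sequence $\boldsymbol\varepsilon=(\varepsilon_0,\dots,\varepsilon_n)$ of augmentations, the adjoint of $$\sum_{i\ge 1}\ \sum_{\substack{i_0+\cdots+i_n+n=i\\ i_j\ge0}}\big(\varepsilon_0^{\boxtimes i_0}\boxtimes\mathrm{id}_M\boxtimes\varepsilon_1^{\boxtimes i_1}\boxtimes\cdots\boxtimes\mathrm{id}_M\boxtimes\varepsilon_n^{\boxtimes i_n}\big)\circ\partial_i\ \colon\ M\to M^{\boxtimes n}$$ restricts to a unique $A$–$A$-bimodule map $\mu_n^{\boldsymbol\varepsilon}\colon M^{\boxtimes n}\to M$. 3. The operations $\mu^{\boldsymbol\varepsilon}_n$ form an $A_\infty$-category over $A$ whose objects are the augmentations and all of whose morphism bimodules are $M$, with the suspended grading in which $|m|$ is one more than the degree of $m$ in $M$. That is, $M$ is the direct sum of its homogeneous parts, $\mu_n^{\boldsymbol\varepsilon}$ has degree $2-n$, and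 for all $n\ge1$, all augmentations $\varepsilon_0,\dots,\varepsilon_n$ and all homogeneous $m_1,\dots,m_n\in M$, $$\sum_{\substack{k+l=n+1\\k,l>0}}\ \sum_{i=1}^k(-1)^{\dagger}\,\mu_k^{(\varepsilon_0,\dots,\varepsilon_{i-1},\varepsilon_{i+l-1},\dots,\varepsilon_n)}\big(m_1,\dots,m_{i-1},\mu_l^{(\varepsilon_{i-1},\dots,\varepsilon_{i+l-1})}(m_i,\dots,m_{i+l-1}),m_{i+l},\dots,m_n\big)=0,$$ where $\dagger=|m_1|+\cdots+|m_{i-1}|+(i-1)$ and $\mu(m_1,\dots,m_n)$ means $\mu(m_1\boxtimes\cdots\boxtimes m_n)$. -/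

import Mathlib

open scoped TensorProduct
open MulOpposite (op unop)

noncomputable section

/-! ### Hermitian algebras (over a commutative ring with trivial conjugation) -/

/-- The pairing `⟨v₁ ⊗ ⋯ ⊗ vₙ, w₁ ⊗ ⋯ ⊗ wₙ⟩ = ∏ β(vᵢ, wᵢ)` on the `n`-th tensor power of an
`R`-module `V` induced by a bilinear pairing `β` on `V`, as a map to the dual module. -/
def powPairing {R V : Type*} [CommRing R] [AddCommGroup V] [Module R V]
    (β : V →ₗ[R] Module.Dual R V) (n : ℕ) :
    TensorPower R n V →ₗ[R] Module.Dual R (TensorPower R n V) :=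
  PiTensorProduct.dualDistrib ∘ₗ PiTensorProduct.map (fun _ : Fin n => β)

/-- A Hermitian algebra structure on the `R`-algebra `A`, where the conjugation of `R` is
trivial: an `R`-linear anti-multiplicative involution and a symmetric bilinear form `t` for which
the adjoint of a multiplication by `a` is the multiplication by `star a`, and such that
all the induced maps `A ⊗ ⋯ ⊗ A → (A ⊗ ⋯ ⊗ A)^*` are injective. -/
structure HermitianAlgebra (R A : Type*) [CommRing R] [Ring A] [Algebra R A] where
  star : A →ₗ[R] A
  star_mul : ∀ a b, star (a * b) = star b * star a
  star_star : ∀ a, star (star a) = a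
  t : A →ₗ[R] Module.Dual R A
  t_symm : ∀ a b, t a b = t b a
  t_mul_left : ∀ a b c, t (b * a) c = t a (star b * c)
  t_mul_right : ∀ a b c, t (b * a) c = t b (c * star a)
  nondegenerate : ∀ n : ℕ, 1 ≤ n → Function.Injective (powPairing t n)

/-! ### Bimodules and the tensor algebra of a bimodule

An `A`-`A`-bimodule (over `R`) is a module over the enveloping algebra `A ⊗ Aᵒᵖ`, where
`(a ⊗ a') • m` is `a m a'`. A free `A`-`A`-bimodule with a preferred basis is a module over the
enveloping algebra with a preferred basis, and a morphism of bimodules is a linear map over the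
enveloping algebra. -/

/-- The enveloping algebra `A ⊗ Aᵒᵖ` of `A`. -/
abbrev Env (R A : Type*) [CommRing R] [Ring A] [Algebra R A] : Type _ := A ⊗[R] Aᵐᵒᵖ

namespace BimodTensor

/-- The relations that turn the tensor algebra over `R` of `A × M` into the tensor algebra over
`A` of the bimodule `M`. -/
inductive Rel (R A M : Type*) [CommRing R] [Ring A] [Algebra R A] [AddCommGroup M] [Module R M]
    [Module (Env R A) M] : TensorAlgebra R (A × M) → TensorAlgebra R (A × M) → Prop
  | one : Rel R A M (TensorAlgebra.ι R ((1 : A), (0 : M))) 1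
  | mul (a a' : A) : Rel R A M
      (TensorAlgebra.ι R (a, (0 : M)) * TensorAlgebra.ι R (a', (0 : M)))
      (TensorAlgebra.ι R (a * a', (0 : M)))
  | left (a : A) (m : M) : Rel R A M
      (TensorAlgebra.ι R (a, (0 : M)) * TensorAlgebra.ι R ((0 : A), m))
      (TensorAlgebra.ι R ((0 : A), (a ⊗ₜ[R] (1 : Aᵐᵒᵖ)) • m))
  | right (m : M) (a : A) : Rel R A M
      (TensorAlgebra.ι R ((0 : A), m) * TensorAlgebra.ι R (a, (0 : M)))
      (TensorAlgebra.ι R ((0 : A), ((1 : A) ⊗ₜ[R] op a) • m))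

end BimodTensor

/-- The tensor algebra `T_A(M) = ⨁ M^{⊠ n}` of an `A`-`A`-bimodule `M`: the `R`-algebra generated
by (the algebra) `A` and (the bimodule) `M`, i.e. the algebra such that an algebra map
out of it is the same as an algebra map on `A` together with a compatible map on `M` (see `lift`
below). -/
def BimodTensor (R A M : Type*) [CommRing R] [Ring A] [Algebra R A] [AddCommGroup M] [Module R M]
    [Module (Env R A) M] : Type _ :=
  RingQuot (BimodTensor.Rel R A M)

namespace BimodTensor

section Basic

variable (R A M : Type*) [CommRing R] [Ring A] [Algebra R A] [AddCommGroup M] [Module R M]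
  [Module (Env R A) M]

instance : Ring (BimodTensor R A M) := inferInstanceAs (Ring (RingQuot (Rel R A M)))

instance : Algebra R (BimodTensor R A M) :=
  inferInstanceAs (Algebra R (RingQuot (Rel R A M)))

/-- The quotient map from the tensor algebra over `R`. -/
def mk : TensorAlgebra R (A × M) →ₐ[R] BimodTensor R A M := RingQuot.mkAlgHom R (Rel R A M)

variable {R A M} in
theorem mk_rel {x y : TensorAlgebra R (A × M)} (h : Rel R A M x y) :
    mk R A M x = mk R A M y := RingQuot.mkAlgHom_rel R h

/-- The inclusion of the zero-length part `A = M^{⊠ 0}`. -/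
def incA : A →ₐ[R] BimodTensor R A M :=
  AlgHom.ofLinearMap
    ((mk R A M).toLinearMap ∘ₗ TensorAlgebra.ι R ∘ₗ LinearMap.inl R A M)
    (by simpa using mk_rel (Rel.one (R := R) (A := A) (M := M)))
    (fun a a' => by
      simpa using (mk_rel (Rel.mul (R := R) (A := A) (M := M) a a')).symm)

/-- The inclusion of `M = M^{⊠ 1}`. -/
def incM : M →ₗ[R] BimodTensor R A M :=
  (mk R A M).toLinearMap ∘ₗ TensorAlgebra.ι R ∘ₗ LinearMap.inr R A M

variable {R A M}

theorem incA_mul_incM (a : A) (m : M) :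
    incA R A M a * incM R A M m = incM R A M ((a ⊗ₜ[R] (1 : Aᵐᵒᵖ)) • m) := by
  simpa [incA, incM] using mk_rel (Rel.left (R := R) (A := A) (M := M) a m)

theorem incM_mul_incA (m : M) (a : A) :
    incM R A M m * incA R A M a = incM R A M (((1 : A) ⊗ₜ[R] op a) • m) := by
  simpa [incA, incM] using mk_rel (Rel.right (R := R) (A := A) (M := M) m a)

/-- The universal property of the tensor algebra of a bimodule. -/
def lift {C : Type*} [Ring C] [Algebra R C] (f : A →ₐ[R] C) (g : M →ₗ[R] C)
    (hl : ∀ (a : A) (m : M), g ((a ⊗ₜ[R] (1 : Aᵐᵒᵖ)) • m) = f a * g m)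
    (hr : ∀ (a : A) (m : M), g (((1 : A) ⊗ₜ[R] op a) • m) = g m * f a) :
    BimodTensor R A M →ₐ[R] C :=
  RingQuot.liftAlgHom R ⟨TensorAlgebra.lift R (f.toLinearMap.coprod g), by
    intro x y h
    induction h with
    | one => simp
    | mul a a' => simp
    | left a m => simp [hl]
    | right m a => simp [hr]⟩

theorem lift_mk {C : Type*} [Ring C] [Algebra R C] (f : A →ₐ[R] C) (g : M →ₗ[R] C)
    (hl : ∀ (a : A) (m : M), g ((a ⊗ₜ[R] (1 : Aᵐᵒᵖ)) • m) = f a * g m)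
    (hr : ∀ (a : A) (m : M), g (((1 : A) ⊗ₜ[R] op a) • m) = g m * f a)
    (x : TensorAlgebra R (A × M)) :
    lift f g hl hr (mk R A M x) = TensorAlgebra.lift R (f.toLinearMap.coprod g) x :=
  RingQuot.liftAlgHom_mkAlgHom_apply R _ _ x

theorem lift_incA {C : Type*} [Ring C] [Algebra R C] (f : A →ₐ[R] C) (g : M →ₗ[R] C)
    (hl : ∀ (a : A) (m : M), g ((a ⊗ₜ[R] (1 : Aᵐᵒᵖ)) • m) = f a * g m)
    (hr : ∀ (a : A) (m : M), g (((1 : A) ⊗ₜ[R] op a) • m) = g m * f a) (a : A) :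
    lift f g hl hr (incA R A M a) = f a := by
  simp [incA, lift_mk]

theorem lift_incM {C : Type*} [Ring C] [Algebra R C] (f : A →ₐ[R] C) (g : M →ₗ[R] C)
    (hl : ∀ (a : A) (m : M), g ((a ⊗ₜ[R] (1 : Aᵐᵒᵖ)) • m) = f a * g m)
    (hr : ∀ (a : A) (m : M), g (((1 : A) ⊗ₜ[R] op a) • m) = g m * f a) (m : M) :
    lift f g hl hr (incM R A M m) = g m := by
  simp [incM, lift_mk]

theorem commute_mul (a : A) (a' : Aᵐᵒᵖ) :
    Commute (((Algebra.lmul R (BimodTensor R A M)).comp (incA R A M)) a)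
      (((Algebra.lsmul R R (BimodTensor R A M)).comp (AlgHom.op (incA R A M))) a') :=
  LinearMap.ext fun x => by simp [mul_assoc]

variable (R A M) in
/-- The bimodule structure of the tensor algebra as an algebra map `A ⊗ Aᵒᵖ → End_R(T_A(M))`. -/
def envAction : Env R A →ₐ[R] Module.End R (BimodTensor R A M) :=
  Algebra.TensorProduct.lift
    ((Algebra.lmul R (BimodTensor R A M)).comp (incA R A M))
    ((Algebra.lsmul R R (BimodTensor R A M)).comp (AlgHom.op (incA R A M)))
    commute_mul

instance : Module (Env R A) (BimodTensor R A M) :=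
  Module.compHom _ (envAction R A M).toRingHom

theorem env_smul_def (z : Env R A) (x : BimodTensor R A M) : z • x = envAction R A M z x := rfl

/-- `(a ⊗ a') • x = a x a'` in the tensor algebra. -/
theorem tmul_smul (a a' : A) (x : BimodTensor R A M) :
    (a ⊗ₜ[R] op a') • x = incA R A M a * (x * incA R A M a') := by
  rw [env_smul_def, envAction, Algebra.TensorProduct.lift_tmul]
  simp

instance : IsScalarTower R (Env R A) (BimodTensor R A M) where
  smul_assoc r z x := by simp [env_smul_def]

end Basic

end BimodTensor

open BimodTensor

/-- The sub-bimodule `M^{⊠ n}` of `T_A(M)`, generated by the products `m₁ ⊠ ⋯ ⊠ mₙ`. -/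
def boxPow (R A M : Type*) [CommRing R] [Ring A] [Algebra R A] [AddCommGroup M] [Module R M]
    [Module (Env R A) M] (n : ℕ) : Submodule (Env R A) (BimodTensor R A M) :=
  Submodule.span (Env R A)
    {x | ∃ m : Fin n → M, x = (List.ofFn fun i => incM R A M (m i)).prod}

/-- The element `m₀ ⊠ m₁ ⊠ ⋯ ⊠ m_{n-1}` of `M^{⊠ n}` given by the first `n` terms of a sequence. -/
def boxProd {R A M : Type*} [CommRing R] [Ring A] [Algebra R A] [AddCommGroup M] [Module R M]
    [Module (Env R A) M] (m : ℕ → M) (n : ℕ) : boxPow R A M n :=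
  ⟨(List.ofFn fun i : Fin n => incM R A M (m i)).prod, Submodule.subset_span ⟨_, rfl⟩⟩

/-- The algebra map `T_A(M) → T_A(M)[X]` that is the identity on `A` and sends `m ∈ M` to `m X`;
its `n`-th coefficient is the projection of `T_A(M)` to the summand `M^{⊠ n}`. -/
def lengthHom (R A M : Type*) [CommRing R] [Ring A] [Algebra R A] [AddCommGroup M] [Module R M]
    [Module (Env R A) M] : BimodTensor R A M →ₐ[R] Polynomial (BimodTensor R A M) :=
  BimodTensor.lift (Polynomial.CAlgHom.comp (incA R A M))
    ((Polynomial.monomial 1).restrictScalars R ∘ₗ incM R A M)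
    (fun a m => by simp [← incA_mul_incM, Polynomial.C_mul_monomial])
    (fun a m => by simp [← incM_mul_incA, Polynomial.monomial_mul_C])

/-- The projection of `T_A(M)` to its length `n` part `M^{⊠ n}`. -/
def lengthProj (R A M : Type*) [CommRing R] [Ring A] [Algebra R A] [AddCommGroup M] [Module R M]
    [Module (Env R A) M] (n : ℕ) : BimodTensor R A M →ₗ[R] BimodTensor R A M :=
  (Polynomial.lcoeff (BimodTensor R A M) n).restrictScalars R ∘ₗ (lengthHom R A M).toLinearMap

/-! ### The pairing on the tensor algebra of a free bimodule over a Hermitian algebra -/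

section Pairing

variable {R A M B : Type*} [CommRing R] [Ring A] [Algebra R A] [AddCommGroup M] [Module R M]
  [Module (Env R A) M] [IsScalarTower R (Env R A) M]

/-- The `R`-module `A ⊗ T_R(⨁_{c ∈ B} A)` of words: the word `a₀ d₁ a₁ ⋯ dₙ aₙ` with `dᵢ ∈ B`
corresponds to `a₀ ⊗ ((d₁, a₁) ⊗ ⋯ ⊗ (dₙ, aₙ))`. -/
abbrev Words (R A B : Type*) [CommRing R] [Ring A] [Algebra R A] : Type _ :=
  A ⊗[R] TensorAlgebra R (B →₀ A)

/-- `a₀ d₁ a₁ ⋯ dₙ aₙ ↦ (c, a₀) ⊗ (d₁, a₁) ⊗ ⋯ ⊗ (dₙ, aₙ)`. -/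
def consLetter (c : B) : Words R A B →ₗ[R] TensorAlgebra R (B →₀ A) :=
  TensorProduct.lift (LinearMap.mul R (TensorAlgebra R (B →₀ A)) ∘ₗ TensorAlgebra.ι R ∘ₗ
    Finsupp.lsingle c)

/-- Left multiplication of words by `a c a'`:
`a₀ d₁ a₁ ⋯ dₙ aₙ ↦ a c (a' a₀) d₁ a₁ ⋯ dₙ aₙ`, as a linear map in `a ⊗ a'`. -/
def mulLetter (c : B) : Env R A →ₗ[R] Module.End R (Words R A B) :=
  TensorProduct.lift
    (LinearMap.mk₂ R
      (fun (a : A) (a' : Aᵐᵒᵖ) => TensorProduct.mk R A (TensorAlgebra R (B →₀ A)) a ∘ₗ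
        consLetter c ∘ₗ Algebra.lsmul R R (Words R A B) (unop a'))
      (fun a₁ a₂ a' => by ext; simp)
      (fun r a a' => by ext; simp [TensorProduct.smul_tmul'])
      (fun a a₁ a₂ => by ext; simp [TensorProduct.tmul_add])
      (fun r a a' => by ext; simp))

theorem consLetter_tmul (c : B) (a : A) (w : TensorAlgebra R (B →₀ A)) :
    consLetter c (a ⊗ₜ[R] w) = TensorAlgebra.ι R (Finsupp.single c a) * w := rfl

theorem mulLetter_tmul (c : B) (a a' a₀ : A) (w : TensorAlgebra R (B →₀ A)) :
    mulLetter c (a ⊗ₜ[R] op a') (a₀ ⊗ₜ[R] w)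
      = a ⊗ₜ[R] (TensorAlgebra.ι R (Finsupp.single c (a' * a₀)) * w) := rfl

/-- Left multiplication of words by an element of `M`, written in the preferred basis. -/
def mulM (b : Module.Basis B (Env R A) M) : M →ₗ[R] Module.End R (Words R A B) :=
  Finsupp.lsum R (fun c => mulLetter c) ∘ₗ (b.repr.toLinearMap.restrictScalars R)

theorem basis_induction (b : Module.Basis B (Env R A) M) {P : M → Prop} (h0 : P 0)
    (hadd : ∀ x y, P x → P y → P (x + y))
    (hb : ∀ (a a' : A) (c : B), P ((a ⊗ₜ[R] op a') • b c)) (m : M) : P m := by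
  obtain ⟨f, rfl⟩ := b.repr.symm.surjective m
  induction f using Finsupp.induction_linear with
  | zero => simpa using h0
  | add f g hf hg => simpa using hadd _ _ hf hg
  | single c z =>
    rw [Module.Basis.repr_symm_single]
    induction z using TensorProduct.induction_on with
    | zero => exact (zero_smul (Env R A) (b c)).symm ▸ h0
    | tmul a a' => simpa using hb a (unop a') c
    | add x y hx hy => simpa [add_smul] using hadd _ _ hx hy

theorem mulM_smul (b : Module.Basis B (Env R A) M) (z : Env R A) (c : B) :
    mulM b (z • b c) = mulLetter c z := by
  simp [mulM]

theorem mulM_left (b : Module.Basis B (Env R A) M) (a : A) (m : M) :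
    mulM b ((a ⊗ₜ[R] (1 : Aᵐᵒᵖ)) • m) = Algebra.lsmul R R (Words R A B) a * mulM b m := by
  induction m using basis_induction b with
  | h0 => simp
  | hadd x y hx hy => simp only [smul_add, map_add, mul_add, hx, hy]
  | hb a₁ a' c =>
    rw [smul_smul, mulM_smul, mulM_smul, Algebra.TensorProduct.tmul_mul_tmul, one_mul]
    ext x w
    simp [mulLetter_tmul, TensorProduct.smul_tmul']

theorem mulM_right (b : Module.Basis B (Env R A) M) (a : A) (m : M) :
    mulM b (((1 : A) ⊗ₜ[R] op a) • m) = mulM b m * Algebra.lsmul R R (Words R A B) a := by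
  induction m using basis_induction b with
  | h0 => simp
  | hadd x y hx hy => simp only [smul_add, map_add, add_mul, hx, hy]
  | hb a₁ a' c =>
    rw [smul_smul, mulM_smul, mulM_smul, Algebra.TensorProduct.tmul_mul_tmul, one_mul,
      ← MulOpposite.op_mul]
    ext x w
    simp only [TensorProduct.AlgebraTensorModule.curry_apply, LinearMap.restrictScalars_self,
      TensorProduct.curry_apply, Module.End.mul_apply, Algebra.lsmul_coe,
      TensorProduct.smul_tmul', smul_eq_mul, mulLetter_tmul, mul_assoc]

/-- Every element of `T_A(M)` as a combination of words: the action of `T_A(M)` on words by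
left multiplication, applied to the empty word `1`. -/
def toWords (b : Module.Basis B (Env R A) M) : BimodTensor R A M →ₗ[R] Words R A B :=
  LinearMap.applyₗ ((1 : A) ⊗ₜ[R] (1 : TensorAlgebra R (B →₀ A))) ∘ₗ
    (BimodTensor.lift (Algebra.lsmul R R (Words R A B)) (mulM b)
      (mulM_left b) (mulM_right b)).toLinearMap

/-- The pairing `⟨f, g⟩ = ∑_c t(f c, g c)` on `⨁_{c ∈ B} A`. -/
def letterPairing (B : Type*) (H : HermitianAlgebra R A) :
    (B →₀ A) →ₗ[R] Module.Dual R (B →₀ A) :=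
  Finsupp.lsum R fun c => (Finsupp.lapply c).dualMap ∘ₗ H.t

/-- The pairing on `T_R(V) = ⨁ V^{⊗ n}` induced by a pairing on `V`, for which the different
tensor powers are orthogonal. -/
def tensorPairing {V : Type*} [AddCommGroup V] [Module R V] (β : V →ₗ[R] Module.Dual R V) :
    TensorAlgebra R V →ₗ[R] Module.Dual R (TensorAlgebra R V) :=
  (TensorAlgebra.toDirectSum (R := R) (M := V)).toLinearMap.dualMap ∘ₗ
    DirectSum.toModule R ℕ _
      (fun n => (DirectSum.component R ℕ (fun n => TensorPower R n V) n).dualMap ∘ₗ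
        powPairing β n) ∘ₗ
    (TensorAlgebra.toDirectSum (R := R) (M := V)).toLinearMap

/-- The pairing on words, with
`⟨a₀ d₁ a₁ ⋯ dₙ aₙ, a₀' d₁' a₁' ⋯ dₙ' aₙ'⟩ = t(a₀, a₀') ⋯ t(aₙ, aₙ')` if `dᵢ = dᵢ'` for all `i`,
and `0` otherwise; words of different lengths are orthogonal. -/
def wordPairing (B : Type*) (H : HermitianAlgebra R A) :
    Words R A B →ₗ[R] Module.Dual R (Words R A B) :=
  TensorProduct.dualDistrib R A (TensorAlgebra R (B →₀ A)) ∘ₗ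
    TensorProduct.map H.t (tensorPairing (letterPairing B H))

/-- The pairing `⟨x, y⟩` on `T_A(M)` induced by the preferred basis of `M` and the Hermitian
form of `A`. Its restriction to `M^{⊠ n}` gives the inclusion `x ↦ ⟨x, ·⟩` of `M^{⊠ n}` in its dual
`R`-module. -/
def pairing (b : Module.Basis B (Env R A) M) (H : HermitianAlgebra R A) :
    BimodTensor R A M →ₗ[R] Module.Dual R (BimodTensor R A M) :=
  (toWords b).dualMap ∘ₗ wordPairing B H ∘ₗ toWords b

end Pairing

/-! ### Semifree differential graded algebras and augmentations -/

section DGA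

variable {R A M B : Type*} [CommRing R] [Ring A] [Algebra R A] [AddCommGroup M] [Module R M]
  [Module (Env R A) M] {μ : ℕ}

/-- The part `M_g` of degree `g` of the bimodule `M` whose preferred basis element `c` has degree
`deg c`. -/
def gradeM (b : Module.Basis B (Env R A) M) (deg : B → ZMod (2 * μ)) (g : ZMod (2 * μ)) :
    Submodule (Env R A) M :=
  Submodule.span (Env R A) {m | ∃ c, deg c = g ∧ m = b c}

/-- The suspended grading of `M`, as a submodule of its dual: `|m|` is one more than the degree
of `m` in `M`. -/
def gradeDual (b : Module.Basis B (Env R A) M) (deg : B → ZMod (2 * μ)) (g : ZMod (2 * μ)) :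
    Submodule (Env R A) M :=
  gradeM b deg (g - 1)

/-- The part of degree `g` of `T_A(M)`: the sub-bimodule generated by the products
`m₁ ⊠ ⋯ ⊠ mₙ` of homogeneous elements whose degrees add up to `g`. The zero-length part `A` has
degree `0`. -/
def gradeT (b : Module.Basis B (Env R A) M) (deg : B → ZMod (2 * μ)) (g : ZMod (2 * μ)) :
    Submodule (Env R A) (BimodTensor R A M) :=
  Submodule.span (Env R A)
    {x | ∃ (n : ℕ) (m : Fin n → M) (e : Fin n → ZMod (2 * μ)),
      (∀ i, m i ∈ gradeM b deg (e i)) ∧ ∑ i, e i = g ∧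
        x = (List.ofFn fun i => incM R A M (m i)).prod}

/-- A differential on the graded algebra `T_A(M)`: a morphism of bimodules of degree `-1` with
square zero that satisfies the graded Leibniz rule. (For `g : ZMod (2 * μ)` the parity of `g.val`
is the parity of `g`, also when `μ = 0`.) -/
structure SemifreeDGA (b : Module.Basis B (Env R A) M) (deg : B → ZMod (2 * μ)) where
  d : BimodTensor R A M →ₗ[Env R A] BimodTensor R A M
  d_sq : ∀ x, d (d x) = 0
  d_degree : ∀ g, ∀ x ∈ gradeT b deg g, d x ∈ gradeT b deg (g - 1)
  leibniz : ∀ g, ∀ x ∈ gradeT b deg g, ∀ y, d (x * y) = d x * y + (-1) ^ g.val * (x * d y)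

/-- An augmentation into `A`: a unital algebra map to `A` that is the identity on the zero-length
part, is graded (`A` has degree `0`) and vanishes on boundaries. -/
structure Augmentation {b : Module.Basis B (Env R A) M} {deg : B → ZMod (2 * μ)}
    (D : SemifreeDGA b deg) where
  toAlgHom : BimodTensor R A M →ₐ[R] A
  map_incA : ∀ a, toAlgHom (incA R A M a) = a
  map_degree : ∀ g, g ≠ 0 → ∀ x ∈ gradeT b deg g, toAlgHom x = 0
  map_d : ∀ x, toAlgHom (D.d x) = 0

/-! ### The operations -/

variable [IsScalarTower R (Env R A) M] {b : Module.Basis B (Env R A) M}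
  {deg : B → ZMod (2 * μ)} {D : SemifreeDGA b deg}

/-- The component `∂ₙ : M → M^{⊠ n}` of the differential. -/
def SemifreeDGA.component (D : SemifreeDGA b deg) (n : ℕ) : M →ₗ[R] BimodTensor R A M :=
  lengthProj R A M n ∘ₗ (D.d.restrictScalars R) ∘ₗ incM R A M

/-- The entries of the matrix of `m`, see `insertHom`. -/
def insertMatrix {n : ℕ} (ε : Fin (n + 1) → Augmentation D) :
    M →ₗ[R] Matrix (Fin (n + 1)) (Fin (n + 1)) (BimodTensor R A M) where
  toFun m := Matrix.of fun i j =>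
    if i = j then incA R A M ((ε i).toAlgHom (incM R A M m))
    else if (i : ℕ) + 1 = j then incM R A M m else 0
  map_add' x y := by
    ext i j
    simp only [Matrix.of_apply, Matrix.add_apply, map_add]
    split_ifs <;> simp
  map_smul' r x := by
    ext i j
    simp only [Matrix.of_apply, Matrix.smul_apply, map_smul, RingHom.id_apply]
    split_ifs <;> simp

/-- The algebra map from `T_A(M)` to upper triangular matrices over `T_A(M)` that sends `a ∈ A` to
the scalar matrix `a`, and `m ∈ M` to the matrix with the entries `ε₀(m), …, εₙ(m)` on the diagonal,
`m` at all places just above the diagonal, and `0` elsewhere. -/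
def insertHom {n : ℕ} (ε : Fin (n + 1) → Augmentation D) :
    BimodTensor R A M →ₐ[R] Matrix (Fin (n + 1)) (Fin (n + 1)) (BimodTensor R A M) :=
  BimodTensor.lift ((Matrix.scalarAlgHom (Fin (n + 1)) R).comp (incA R A M)) (insertMatrix ε)
    (fun a m => by
      ext i j
      simp only [insertMatrix, LinearMap.coe_mk, AddHom.coe_mk, Matrix.of_apply, AlgHom.comp_apply,
        Matrix.scalarAlgHom_apply, Matrix.scalar_apply, Matrix.diagonal_mul,
        ← incA_mul_incM, map_mul, Augmentation.map_incA]
      split_ifs <;> simp)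
    (fun a m => by
      ext i j
      simp only [insertMatrix, LinearMap.coe_mk, AddHom.coe_mk, Matrix.of_apply, AlgHom.comp_apply,
        Matrix.scalarAlgHom_apply, Matrix.scalar_apply, Matrix.mul_diagonal,
        ← incM_mul_incA, map_mul, Augmentation.map_incA]
      split_ifs <;> simp)

/-- The map `∑ ε₀^{⊠ i₀} ⊠ id_M ⊠ ε₁^{⊠ i₁} ⊠ id_M ⊠ ⋯ ⊠ id_M ⊠ εₙ^{⊠ iₙ}`, where the sum is over all
`i₀, …, iₙ ≥ 0`, from `T_A(M)` to `M^{⊠ n}`. It is the upper right entry of the above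
matrices: by matrix multiplication, this entry for a product `m₁ ⋯ mᵢ` is the sum over the
monotone paths from `0` to `n`; a path that stays at `j` at the `p`-th step contributes the factor
`εⱼ(m_p)`, and one that goes from `j` to `j + 1` contributes the factor `m_p`. -/
def insertAug {n : ℕ} (ε : Fin (n + 1) → Augmentation D) :
    BimodTensor R A M →ₗ[R] BimodTensor R A M :=
  Matrix.entryLinearMap R (BimodTensor R A M) 0 (Fin.last n) ∘ₗ (insertHom ε).toLinearMap

/-- The deformed component
`∑ᵢ ∑_{i₀ + ⋯ + iₙ + n = i} (ε₀^{⊠ i₀} ⊠ id_M ⊠ ε₁^{⊠ i₁} ⊠ ⋯ ⊠ id_M ⊠ εₙ^{⊠ iₙ}) ∘ ∂ᵢ`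
from `M` to `M^{⊠ n}`. -/
def deformedComponent {n : ℕ} (ε : Fin (n + 1) → Augmentation D) : M →ₗ[R] BimodTensor R A M :=
  insertAug ε ∘ₗ (D.d.restrictScalars R) ∘ₗ incM R A M

/-- The morphism of bimodules `ν : M^{⊠ n} → M` is the restriction of the adjoint
`f^* : (M^{⊠ n})^* → M^*` of the map `f : M → M^{⊠ n}`, where `M^{⊠ n}` and `M` are
mapped to their duals by the pairing: `f^*(⟨w, ·⟩) = ⟨ν w, ·⟩` in `M^*` for all `w`. -/
def IsAdjoint (b : Module.Basis B (Env R A) M) (H : HermitianAlgebra R A) {n : ℕ}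
    (f : M →ₗ[R] BimodTensor R A M) (ν : boxPow R A M n →ₗ[Env R A] M) : Prop :=
  ∀ w : boxPow R A M n,
    f.dualMap (pairing b H w) = (incM R A M).dualMap (pairing b H (incM R A M (ν w)))

end DGA

/-! ### `A_∞`-categories -/

/-- Operations `op n (X₀, …, Xₙ) : Hom(X₀, X₁) ⊠ ⋯ ⊠ Hom(X_{n-1}, Xₙ) → Hom(X₀, Xₙ)`, `n ≥ 1`, that
are morphisms of bimodules form an `A_∞`-category over `A` with the class of objects `Ob`, all of
whose graded morphism bimodules `Hom(X, Y)` are the same bimodule `M = ⨁ gr g`. The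
objects `X₀, X₁, …` and the morphisms `m₀, m₁, …` with `mⱼ ∈ Hom(Xⱼ, Xⱼ₊₁)` are written as
infinite sequences, of which only the first `n + 1`, respectively `n`, terms matter. -/
structure IsAInfinityCategory {R A M : Type*} [CommRing R] [Ring A] [Algebra R A]
    [AddCommGroup M] [Module R M] [Module (Env R A) M] {μ : ℕ}
    (gr : ZMod (2 * μ) → Submodule (Env R A) M) (Ob : Type*)
    (op : ∀ n : ℕ, (Fin (n + 1) → Ob) → (boxPow R A M n →ₗ[Env R A] M)) : Prop where
  /-- The morphism bimodule is graded. -/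
  internal : DirectSum.IsInternal gr
  /-- The operation with `n` inputs has degree `2 - n`. -/
  degree : ∀ n : ℕ, 1 ≤ n → ∀ (X : ℕ → Ob) (m : ℕ → M) (g : ℕ → ZMod (2 * μ)),
    (∀ j < n, m j ∈ gr (g j)) →
      op n (fun j : Fin (n + 1) => X j) (boxProd m n) ∈ gr (∑ j ∈ Finset.range n, g j + 2 - n)
  /-- The sum over all `k, l > 0` with `k + l = n + 1` and all `i < k` of
  `± op k (m₀, …, m_{i-1}, op l (mᵢ, …, m_{i+l-1}), m_{i+l}, …, m_{n-1})` vanishes, where the outer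
  operation is the one for `X₀, …, Xᵢ, X_{i+l}, …, Xₙ` and the inner one the one for
  `Xᵢ, …, X_{i+l}`. The sign is `(-1)^(|m₀| + ⋯ + |m_{i-1}| + i)`. -/
  relation : ∀ n : ℕ, 1 ≤ n → ∀ (X : ℕ → Ob) (m : ℕ → M) (g : ℕ → ZMod (2 * μ)),
    (∀ j < n, m j ∈ gr (g j)) →
      ∑ p ∈ (Finset.HasAntidiagonal.antidiagonal (n + 1)).filter (fun p => 0 < p.1 ∧ 0 < p.2),
        ∑ i ∈ Finset.range p.1,
          (-1 : ℤ) ^ ((∑ j ∈ Finset.range i, g j).val + i) •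
            op p.1 (fun j : Fin (p.1 + 1) => if (j : ℕ) ≤ i then X j else X (j + p.2 - 1))
              (boxProd
                (fun j : ℕ =>
                  if j < i then m j
                  else if j = i then
                    op p.2 (fun t : Fin (p.2 + 1) => X (i + t)) (boxProd (fun t : ℕ => m (i + t)) p.2)
                  else m (j + p.2 - 1))
                p.1) = 0

end

/-! The pairing on $T_A(M)$ is computed by peeling off leading letters: $\langle a\,c\,x,
a'c'x'\rangle$ is $\mathfrak t(a,a')\langle x,x'\rangle$ if $c=c'$ and $0$ otherwise. Hence words of
different length or degree are orthogonal, multiplication by $p\in A$ on either side is adjoint to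
multiplication by $p^\star$, and two factors $w,y$ of equal length on the left can be traded for one
coefficient: $\langle wz,yz'\rangle=\langle kz,z'\rangle$ with $k\in A$ (`exists_pairing_mul_mul`).

Existence of adjoints: for words of length $n\ge1$ the functional $(p,q)\mapsto\langle
w,p\,y\,q\rangle$ is $(p,q)\mapsto\langle u\cdot c,p\,c\,q\rangle$ for some $u\in A\otimes A^{op}$
(`exists_pairing_env`); taking $y=f(c)$ and summing over the finite basis gives $\nu(w)$.
Nondegeneracy on $A^{\otimes2}$ embeds $M$ in its dual (`eq_of_pairing`), which gives uniqueness,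
and with the adjunction for $\star$ also bimodule linearity (`existsUnique_isAdjoint`).

The $A_\infty$ relations are dual to $\partial^2=0$. Inserting augmentations is a sum over monotone
paths (`path`). Applied to $\partial x$, the Leibniz rule and $\varepsilon\circ\partial=0$ leave
exactly the terms in which one retained factor is replaced by a deformed component (`path_d`). The
adjoint of such a term is taken factor by factor (`pairing_prod_path`), and is the inner operation
followed by the outer one; the Leibniz signs become $(-1)^\dagger$ under the degree shift. For
$x=\partial m$ the left side vanishes, and pairing with $m_1\boxtimes\cdots\boxtimes m_n$ gives the
relation tested against $m$. -/

open scoped TensorProduct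
open MulOpposite (op unop)
open BimodTensor

noncomputable section

/-! ### The pairing on the tensor algebra over $R$. -/

section TensorPairing

variable {R V : Type*} [CommRing R] [AddCommGroup V] [Module R V]

theorem powPairing_tprod (β : V →ₗ[R] Module.Dual R V) (n : ℕ) (x y : Fin n → V) :
    powPairing β n (PiTensorProduct.tprod R x) (PiTensorProduct.tprod R y) = ∏ i, β (x i) (y i) := by
  simp [powPairing, PiTensorProduct.map_tprod, PiTensorProduct.dualDistrib_apply]

theorem tensorPairing_tprod_self (β : V →ₗ[R] Module.Dual R V) (n : ℕ) (x y : Fin n → V) :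
    tensorPairing β (TensorAlgebra.tprod R V n x) (TensorAlgebra.tprod R V n y) =
      ∏ i, β (x i) (y i) := by
  rw [tensorPairing, LinearMap.comp_apply, LinearMap.comp_apply, AlgHom.toLinearMap_apply,
    TensorAlgebra.toDirectSum_tensorPower_tprod, ← DirectSum.lof_eq_of R, DirectSum.toModule_lof,
    LinearMap.dualMap_apply, AlgHom.toLinearMap_apply,
    TensorAlgebra.toDirectSum_tensorPower_tprod, ← DirectSum.lof_eq_of R, LinearMap.comp_apply,
    LinearMap.dualMap_apply, DirectSum.component.lof_self, powPairing_tprod]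

theorem tensorPairing_tprod_of_ne (β : V →ₗ[R] Module.Dual R V) {n m : ℕ} (h : n ≠ m)
    (x : Fin n → V) (y : Fin m → V) :
    tensorPairing β (TensorAlgebra.tprod R V n x) (TensorAlgebra.tprod R V m y) = 0 := by
  rw [tensorPairing, LinearMap.comp_apply, LinearMap.comp_apply, AlgHom.toLinearMap_apply,
    TensorAlgebra.toDirectSum_tensorPower_tprod, ← DirectSum.lof_eq_of R, DirectSum.toModule_lof,
    LinearMap.dualMap_apply, AlgHom.toLinearMap_apply,
    TensorAlgebra.toDirectSum_tensorPower_tprod, ← DirectSum.lof_eq_of R, LinearMap.comp_apply,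
    LinearMap.dualMap_apply, DirectSum.component.of, dif_neg h.symm, map_zero]

/-- Transported from $\bigoplus_n V^{\otimes n}$, where scaled pure tensors span; zero is covered by
the scalar $r=0$. -/
theorem tensorAlgebra_tprod_induction {P : TensorAlgebra R V → Prop}
    (add : ∀ x y, P x → P y → P (x + y))
    (smul_tprod : ∀ (r : R) n x, P (r • TensorAlgebra.tprod R V n x)) (x : TensorAlgebra R V) :
    P x := by
  obtain ⟨z, rfl⟩ := TensorAlgebra.equivDirectSum.symm.surjective x
  induction z using DirectSum.induction_on with
  | zero => simpa using smul_tprod 0 0 0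
  | add x y hx hy => rw [map_add]; exact add _ _ hx hy
  | of n z =>
    induction z using PiTensorProduct.induction_on with
    | smul_tprod r f =>
      rw [← DirectSum.lof_eq_of R, map_smul, map_smul, DirectSum.lof_eq_of,
        TensorAlgebra.equivDirectSum_symm_apply, TensorAlgebra.ofDirectSum_of_tprod]
      exact smul_tprod r n f
    | add x y hx hy => rw [map_add, map_add]; exact add _ _ hx hy

theorem ι_mul_tprod (v : V) (n : ℕ) (x : Fin n → V) :
    TensorAlgebra.ι R v * TensorAlgebra.tprod R V n x =
      TensorAlgebra.tprod R V (n + 1) (Fin.cons v x) := by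
  simp [TensorAlgebra.tprod_apply, List.ofFn_succ]

theorem tensorPairing_one_one (β : V →ₗ[R] Module.Dual R V) : tensorPairing β 1 1 = 1 := by
  simpa [TensorAlgebra.tprod_apply] using tensorPairing_tprod_self β 0 0 0

theorem tensorPairing_one_ι_mul (β : V →ₗ[R] Module.Dual R V) (v : V) (x : TensorAlgebra R V) :
    tensorPairing β 1 (TensorAlgebra.ι R v * x) = 0 := by
  induction x using tensorAlgebra_tprod_induction with
  | add x y hx hy => rw [mul_add, map_add, hx, hy, add_zero]
  | smul_tprod r n x =>
    rw [mul_smul_comm, map_smul, ι_mul_tprod]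
    have := tensorPairing_tprod_of_ne β (Nat.succ_ne_zero n).symm 0 (Fin.cons v x)
    simp only [TensorAlgebra.tprod_apply (R := R) (M := V) (n := 0), List.ofFn_zero, List.prod_nil] at this
    rw [this, smul_zero]

theorem tensorPairing_ι_mul_one (β : V →ₗ[R] Module.Dual R V) (v : V) (x : TensorAlgebra R V) :
    tensorPairing β (TensorAlgebra.ι R v * x) 1 = 0 := by
  induction x using tensorAlgebra_tprod_induction with
  | add x y hx hy => rw [mul_add, map_add, LinearMap.add_apply, hx, hy, add_zero]
  | smul_tprod r n x =>
    rw [mul_smul_comm, map_smul, ι_mul_tprod]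
    have := tensorPairing_tprod_of_ne β (Nat.succ_ne_zero n) (Fin.cons v x) 0
    simp only [TensorAlgebra.tprod_apply (R := R) (M := V) (n := 0), List.ofFn_zero, List.prod_nil] at this
    rw [LinearMap.smul_apply, this, smul_zero]

/-- On pure tensors of equal length this splits off the first factor of a product; for unequal
lengths both sides vanish. -/
theorem tensorPairing_ι_mul_ι_mul (β : V →ₗ[R] Module.Dual R V) (v w : V)
    (x y : TensorAlgebra R V) :
    tensorPairing β (TensorAlgebra.ι R v * x) (TensorAlgebra.ι R w * y) =
      β v w * tensorPairing β x y := by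
  induction x using tensorAlgebra_tprod_induction with
  | add x x' hx hx' => simp only [mul_add, map_add, LinearMap.add_apply, hx, hx']
  | smul_tprod r n x =>
    induction y using tensorAlgebra_tprod_induction with
    | add y y' hy hy' => simp only [mul_add, map_add, hy, hy']
    | smul_tprod r' m y =>
      simp only [mul_smul_comm, map_smul, LinearMap.smul_apply, ι_mul_tprod]
      congr 2
      by_cases h : n = m
      · subst h
        rw [tensorPairing_tprod_self, tensorPairing_tprod_self, Fin.prod_univ_succ]
        simp
      · rw [tensorPairing_tprod_of_ne β h, tensorPairing_tprod_of_ne β (by omega), mul_zero]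

end TensorPairing

/-! ### The pairing on $T_A(M)$: recursion over letters and nondegeneracy. -/

section Pairing

variable {R A M B : Type*} [CommRing R] [Ring A] [Algebra R A] [AddCommGroup M] [Module R M]
  [Module (Env R A) M] [IsScalarTower R (Env R A) M]

theorem letterPairing_single (H : HermitianAlgebra R A) [DecidableEq B] (c c' : B) (a a' : A) :
    letterPairing B H (Finsupp.single c a) (Finsupp.single c' a') =
      if c = c' then H.t a a' else 0 := by
  simp only [letterPairing, Finsupp.lsum_single, LinearMap.comp_apply, LinearMap.dualMap_apply,
    Finsupp.lapply_apply, Finsupp.single_apply, eq_comm (a := c')]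
  split_ifs <;> simp

theorem wordPairing_tmul (H : HermitianAlgebra R A) (a a' : A) (x x' : TensorAlgebra R (B →₀ A)) :
    wordPairing B H (a ⊗ₜ x) (a' ⊗ₜ x') = H.t a a' * tensorPairing (letterPairing B H) x x' := by
  simp [wordPairing]

theorem wordPairing_cons [DecidableEq B] (H : HermitianAlgebra R A) (a a' : A) (c c' : B)
    (x x' : Words R A B) :
    wordPairing B H (a ⊗ₜ consLetter c x) (a' ⊗ₜ consLetter c' x') =
      if c = c' then H.t a a' * wordPairing B H x x' else 0 := by
  induction x using TensorProduct.induction_on with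
  | zero => simp
  | add x y hx hy =>
    simp only [map_add, TensorProduct.tmul_add, LinearMap.add_apply, hx, hy]
    split_ifs <;> ring
  | tmul a₁ x =>
    induction x' using TensorProduct.induction_on with
    | zero => simp
    | add x y hx hy =>
      simp only [map_add, TensorProduct.tmul_add, hx, hy]
      split_ifs <;> ring
    | tmul a₁' x' =>
      rw [consLetter_tmul, consLetter_tmul, wordPairing_tmul, wordPairing_tmul,
        tensorPairing_ι_mul_ι_mul, letterPairing_single]
      split_ifs <;> ring

theorem wordPairing_one_cons (H : HermitianAlgebra R A) (a a' : A) (c' : B) (x' : Words R A B) :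
    wordPairing B H (a ⊗ₜ 1) (a' ⊗ₜ consLetter c' x') = 0 := by
  induction x' using TensorProduct.induction_on with
  | zero => simp
  | add x y hx hy => simp only [map_add, TensorProduct.tmul_add, hx, hy, add_zero]
  | tmul a₁ x => rw [consLetter_tmul, wordPairing_tmul, tensorPairing_one_ι_mul, mul_zero]

theorem wordPairing_cons_one (H : HermitianAlgebra R A) (a a' : A) (c' : B) (x' : Words R A B) :
    wordPairing B H (a' ⊗ₜ consLetter c' x') (a ⊗ₜ 1) = 0 := by
  induction x' using TensorProduct.induction_on with
  | zero => simp
  | add x y hx hy =>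
    simp only [map_add, TensorProduct.tmul_add, LinearMap.add_apply, hx, hy, add_zero]
  | tmul a₁ x => rw [consLetter_tmul, wordPairing_tmul, tensorPairing_ι_mul_one, mul_zero]

variable (b : Module.Basis B (Env R A) M)

theorem toWords_incA (a : A) : toWords b (incA R A M a) = a ⊗ₜ 1 := by
  simp [toWords, lift_incA, TensorProduct.smul_tmul']

theorem mulLetter_apply (c : B) (a a' : A) (x : Words R A B) :
    mulLetter c (a ⊗ₜ[R] op a') x = a ⊗ₜ consLetter c (a' • x) := rfl

/-- `toWords` comes from an action of $T_A(M)$ on words, so left multiplication by $a\,c$ becomes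
prefixing. -/
theorem toWords_cons (a : A) (c : B) (x : BimodTensor R A M) :
    toWords b (incA R A M a * incM R A M (b c) * x) = a ⊗ₜ consLetter c (toWords b x) := by
  rw [incA_mul_incM]
  simp only [toWords, LinearMap.comp_apply, AlgHom.toLinearMap_apply, map_mul, lift_incM,
    mulM_smul, LinearMap.applyₗ_apply_apply, Module.End.mul_apply]
  rw [← MulOpposite.op_one, mulLetter_apply, one_smul]

variable (H : HermitianAlgebra R A)

/-- This and the next three identities determine the pairing recursively; everything later rests on
them and not on the model by words. -/
theorem pairing_incA_incA (a a' : A) :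
    pairing b H (incA R A M a) (incA R A M a') = H.t a a' := by
  simp [pairing, toWords_incA, wordPairing_tmul, tensorPairing_one_one]

theorem pairing_incA_cons (a a' : A) (c : B) (x : BimodTensor R A M) :
    pairing b H (incA R A M a) (incA R A M a' * incM R A M (b c) * x) = 0 := by
  simp only [pairing, LinearMap.comp_apply, LinearMap.dualMap_apply, toWords_incA, toWords_cons,
    wordPairing_one_cons]

theorem pairing_cons_incA (a a' : A) (c : B) (x : BimodTensor R A M) :
    pairing b H (incA R A M a' * incM R A M (b c) * x) (incA R A M a) = 0 := by
  simp only [pairing, LinearMap.comp_apply, LinearMap.dualMap_apply, toWords_incA, toWords_cons,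
    wordPairing_cons_one]

theorem pairing_cons_cons [DecidableEq B] (a a' : A) (c c' : B) (x x' : BimodTensor R A M) :
    pairing b H (incA R A M a * incM R A M (b c) * x) (incA R A M a' * incM R A M (b c') * x') =
      if c = c' then H.t a a' * pairing b H x x' else 0 := by
  simp only [pairing, LinearMap.comp_apply, LinearMap.dualMap_apply, toWords_cons,
    wordPairing_cons]

/-- The isomorphism of `A ⊗ Aᵒᵖ` with the tensor power `A^{⊗ 2}`. -/
def envToPow (R A : Type*) [CommRing R] [Ring A] [Algebra R A] : Env R A ≃ₗ[R] TensorPower R 2 A :=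
  (TensorProduct.congr
    (PiTensorProduct.subsingletonEquiv (R := R) (s := fun _ : Fin 1 => A) 0).symm
    ((MulOpposite.opLinearEquiv R).symm.trans
      (PiTensorProduct.subsingletonEquiv (R := R) (s := fun _ : Fin 1 => A) 0).symm)).trans
    (TensorPower.mulEquiv (n := 1) (m := 1))

theorem envToPow_tmul (a a' : A) :
    envToPow R A (a ⊗ₜ op a') = PiTensorProduct.tprod R ![a, a'] := by
  rw [envToPow, LinearEquiv.trans_apply, TensorProduct.congr_tmul, ← TensorPower.gMul_def,
    LinearEquiv.trans_apply, PiTensorProduct.subsingletonEquiv_symm_apply',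
    PiTensorProduct.subsingletonEquiv_symm_apply', TensorPower.tprod_mul_tprod]
  congr 1
  ext i
  fin_cases i <;> rfl

omit [IsScalarTower R (Env R A) M] in
theorem incM_env_smul (a a' : A) (m : M) :
    incM R A M ((a ⊗ₜ[R] op a') • m) = incA R A M a * incM R A M m * incA R A M a' := by
  rw [incA_mul_incM, incM_mul_incA, smul_smul, Algebra.TensorProduct.tmul_mul_tmul, one_mul, mul_one]

theorem pairing_env_smul [DecidableEq B] (u : Env R A) (p q : A) (c c' : B) :
    pairing b H (incM R A M (u • b c)) (incM R A M ((p ⊗ₜ[R] op q) • b c')) =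
      if c = c' then
        powPairing H.t 2 (envToPow R A u) (envToPow R A (p ⊗ₜ op q)) else 0 := by
  induction u using TensorProduct.induction_on with
  | zero =>
    have : (0 : Env R A) • b c = 0 := zero_smul (Env R A) (b c)
    simp [this]
  | add x y hx hy =>
    rw [add_smul, map_add, map_add, LinearMap.add_apply, hx, hy]
    split_ifs <;> simp
  | tmul a a' =>
    obtain ⟨a', rfl⟩ := MulOpposite.op_surjective a'
    rw [incM_env_smul, incM_env_smul, pairing_cons_cons, pairing_incA_incA, envToPow_tmul,
      envToPow_tmul, powPairing_tprod]
    simp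

/-- Nondegeneracy of the Hermitian form for $n=2$: a coefficient in $A\otimes A^{op}$ is detected by
pairing with pure tensors. -/
theorem eq_zero_of_powPairing (u : Env R A)
    (h : ∀ p q : A, powPairing H.t 2 (envToPow R A u) (envToPow R A (p ⊗ₜ op q)) = 0) : u = 0 := by
  apply (envToPow R A).injective
  apply H.nondegenerate 2 (by norm_num)
  rw [map_zero, map_zero]
  ext f
  have := h (f 0) (f 1)
  rw [envToPow_tmul] at this
  simp only [LinearMap.compMultilinearMap_apply, LinearMap.zero_apply]
  rw [← this]
  congr 2
  ext i
  fin_cases i <;> rfl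

theorem incM_pairing_apply_repr (m : M) (p q : A) (c : B) :
    pairing b H (incM R A M m) (incM R A M ((p ⊗ₜ[R] op q) • b c)) =
      powPairing H.t 2 (envToPow R A (b.repr m c)) (envToPow R A (p ⊗ₜ op q)) := by
  classical
  induction m using basis_induction b with
  | h0 => simp
  | hadd x y hx hy => simp only [map_add, LinearMap.add_apply, hx, hy, Finsupp.add_apply]
  | hb a a' c' =>
    rw [pairing_env_smul, map_smul, Module.Basis.repr_self, Finsupp.smul_single, smul_eq_mul,
      mul_one, Finsupp.single_apply]
    split_ifs <;> simp

theorem repr_eq_zero_of_pairing (m : M) (c : B)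
    (h : ∀ p q : A, pairing b H (incM R A M m) (incM R A M ((p ⊗ₜ[R] op q) • b c)) = 0) :
    b.repr m c = 0 :=
  eq_zero_of_powPairing H _ fun p q => by rw [← incM_pairing_apply_repr, h]

/-- The pairing embeds $M$ in its dual, since each basis coefficient can be tested separately. All
identities in $M$ below are proved in this way. -/
theorem eq_of_pairing (m m' : M)
    (h : ∀ x : M, pairing b H (incM R A M m) (incM R A M x) =
      pairing b H (incM R A M m') (incM R A M x)) : m = m' := by
  rw [← sub_eq_zero, ← b.repr.map_eq_zero_iff]
  ext1 c
  refine repr_eq_zero_of_pairing b H _ c fun p q => ?_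
  rw [map_sub, map_sub, LinearMap.sub_apply, h, sub_self]

theorem t_nondegenerate (a a' : A) (h : ∀ x, H.t a x = H.t a' x) : a = a' := by
  apply (PiTensorProduct.subsingletonEquiv (R := R) (s := fun _ : Fin 1 => A) 0).symm.injective
  apply H.nondegenerate 1 le_rfl
  ext f
  simp [PiTensorProduct.subsingletonEquiv_symm_apply', powPairing_tprod, h]

end Pairing

/-! ### Homogeneous elements as sums of words, for length, degree and the trivial grading. -/

section Homogeneous

variable {R A M B : Type*} [CommRing R] [Ring A] [Algebra R A] [AddCommGroup M] [Module R M]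
  [Module (Env R A) M]

/-- `IsHom b deg g x` says that `x` is a sum of words `a₀ d₁ a₁ ⋯ dₙ aₙ` in the basis `b` with
`deg d₁ + ⋯ + deg dₙ = g`, where `deg` takes values in any additive monoid. -/
inductive IsHom {Γ : Type*} [AddMonoid Γ] (b : Module.Basis B (Env R A) M) (deg : B → Γ) :
    Γ → BimodTensor R A M → Prop
  | zero (g : Γ) : IsHom b deg g 0
  | add {g : Γ} {x y : BimodTensor R A M} :
      IsHom b deg g x → IsHom b deg g y → IsHom b deg g (x + y)
  | incA (a : A) : IsHom b deg 0 (incA R A M a)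
  | cons (a : A) (c : B) {g : Γ} {x : BimodTensor R A M} :
      IsHom b deg g x → IsHom b deg (deg c + g) (BimodTensor.incA R A M a * incM R A M (b c) * x)

variable {Γ : Type*} [AddMonoid Γ] {b : Module.Basis B (Env R A) M} {deg : B → Γ}

theorem IsHom.incA_mul {g : Γ} {x : BimodTensor R A M} (h : IsHom b deg g x) (a : A) :
    IsHom b deg g (BimodTensor.incA R A M a * x) := by
  induction h with
  | zero g => rw [mul_zero]; exact .zero g
  | add _ _ hx hy => rw [mul_add]; exact hx.add hy
  | incA a' => rw [← map_mul]; exact .incA _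
  | cons a' c h _ => rw [← mul_assoc, ← mul_assoc, ← map_mul]; exact h.cons _ c

theorem IsHom.mul {g g' : Γ} {x y : BimodTensor R A M} (hx : IsHom b deg g x)
    (hy : IsHom b deg g' y) : IsHom b deg (g + g') (x * y) := by
  induction hx with
  | zero g => rw [zero_mul]; exact .zero _
  | add _ _ hx hx' => rw [add_mul]; exact hx.add hx'
  | incA a' => rw [zero_add]; exact hy.incA_mul a'
  | cons a' c h ih => rw [mul_assoc, add_assoc]; exact ih.cons _ c

theorem IsHom.mul_incA {g : Γ} {x : BimodTensor R A M} (h : IsHom b deg g x) (a : A) :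
    IsHom b deg g (x * BimodTensor.incA R A M a) := by
  simpa using h.mul (.incA a)

theorem IsHom.smul {g : Γ} {x : BimodTensor R A M} (h : IsHom b deg g x) (z : Env R A) :
    IsHom b deg g (z • x) := by
  induction z using TensorProduct.induction_on with
  | zero =>
    have : (0 : Env R A) • x = 0 := zero_smul (Env R A) x
    exact this ▸ .zero g
  | tmul a a' =>
    obtain ⟨a', rfl⟩ := MulOpposite.op_surjective a'
    rw [tmul_smul]
    exact (h.mul_incA a').incA_mul a
  | add y z hy hz => rw [add_smul]; exact hy.add hz

theorem isHom_basis (c : B) : IsHom b deg (deg c) (incM R A M (b c)) := by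
  simpa using (IsHom.incA (b := b) (deg := deg) 1).cons 1 c

theorem incM_smul (z : Env R A) (m : M) : incM R A M (z • m) = z • incM R A M m := by
  induction z using TensorProduct.induction_on with
  | zero =>
    have h : (0 : Env R A) • m = 0 := zero_smul (Env R A) m
    have h' : (0 : Env R A) • incM R A M m = 0 := zero_smul (Env R A) (incM R A M m)
    rw [h, h', map_zero]
  | tmul a a' =>
    obtain ⟨a', rfl⟩ := MulOpposite.op_surjective a'
    rw [incM_env_smul, tmul_smul, mul_assoc]
  | add y z hy hz => rw [add_smul, add_smul, map_add, hy, hz]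

theorem IsHom.of_mem_span {g : Γ} {s : Set M} (hs : ∀ m ∈ s, IsHom b deg g (incM R A M m)) {m : M}
    (hm : m ∈ Submodule.span (Env R A) s) : IsHom b deg g (incM R A M m) := by
  induction hm using Submodule.span_induction with
  | mem m h => exact hs m h
  | zero => rw [map_zero]; exact .zero g
  | add x y _ _ hx hy => rw [map_add]; exact hx.add hy
  | smul z x _ hx => rw [incM_smul]; exact hx.smul z

theorem IsHom.prod (n : ℕ) (m : Fin n → BimodTensor R A M) (e : Fin n → Γ)
    (h : ∀ i, IsHom b deg (e i) (m i)) :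
    IsHom b deg (List.ofFn e).sum (List.ofFn m).prod := by
  induction n with
  | zero => simpa using IsHom.incA (b := b) (deg := deg) (1 : A)
  | succ n ih =>
    rw [List.ofFn_succ, List.ofFn_succ, List.sum_cons, List.prod_cons]
    exact (h 0).mul (ih _ _ fun i => h i.succ)

/-- Every element of `M` has length `1`. -/
theorem isHom_length_incM [IsScalarTower R (Env R A) M] (b : Module.Basis B (Env R A) M) (m : M) :
    IsHom b (fun _ => 1) 1 (incM R A M m) := by
  refine IsHom.of_mem_span (s := Set.range b) ?_ (b.mem_span m)
  rintro _ ⟨c, rfl⟩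
  exact isHom_basis (deg := fun _ => 1) c

theorem isHom_of_mem_boxPow [IsScalarTower R (Env R A) M] (b : Module.Basis B (Env R A) M) {n : ℕ}
    {x : BimodTensor R A M} (hx : x ∈ boxPow R A M n) : IsHom b (fun _ => 1) n x := by
  induction hx using Submodule.span_induction with
  | mem x h =>
    obtain ⟨m, rfl⟩ := h
    have := IsHom.prod (b := b) n (fun i => incM R A M (m i)) (fun _ => 1)
      fun i => isHom_length_incM b (m i)
    simpa using this
  | zero => exact .zero n
  | add x y _ _ hx hy => exact hx.add hy
  | smul z x _ hx => exact hx.smul z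

theorem isHom_of_mem_gradeM {μ : ℕ} {deg : B → ZMod (2 * μ)} {g : ZMod (2 * μ)} {m : M}
    (hm : m ∈ gradeM b deg g) : IsHom b deg g (incM R A M m) := by
  refine IsHom.of_mem_span ?_ hm
  rintro _ ⟨c, rfl, rfl⟩
  exact isHom_basis c

theorem isHom_of_mem_gradeT {μ : ℕ} {deg : B → ZMod (2 * μ)} {g : ZMod (2 * μ)}
    {x : BimodTensor R A M} (hx : x ∈ gradeT b deg g) : IsHom b deg g x := by
  induction hx using Submodule.span_induction with
  | mem x h =>
    obtain ⟨n, m, e, hm, rfl, rfl⟩ := h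
    rw [← List.sum_ofFn]
    exact IsHom.prod n _ e fun i => isHom_of_mem_gradeM (hm i)
  | zero => exact .zero g
  | add x y _ _ hx hy => exact hx.add hy
  | smul z x _ hx => exact hx.smul z

/-- Induction on the elements of `T_A(M)` by left multiplication with elements of `A` and of
`M`. -/
theorem BimodTensor.induction_left {P : BimodTensor R A M → Prop}
    (add : ∀ x y, P x → P y → P (x + y)) (incA : ∀ a, P (incA R A M a))
    (incA_mul : ∀ a x, P x → P (BimodTensor.incA R A M a * x))
    (incM_mul : ∀ m x, P x → P (incM R A M m * x)) (x : BimodTensor R A M) : P x := by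
  obtain ⟨y, rfl⟩ := RingQuot.mkAlgHom_surjective R (Rel R A M) x
  change P (mk R A M y)
  -- Stability under left multiplication by the class of $y$ is closed under products in $y$, unlike
  -- $P$ itself.
  suffices h : ∀ z, P z → P (mk R A M y * z) by
    simpa using h 1 (by simpa using incA 1)
  induction y using TensorAlgebra.induction with
  | algebraMap r =>
    intro z hz
    rw [AlgHom.commutes, ← (BimodTensor.incA R A M).commutes r]
    exact incA_mul _ z hz
  | ι y =>
    intro z hz
    have : mk R A M (TensorAlgebra.ι R y) =
        BimodTensor.incA R A M y.1 + incM R A M y.2 := by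
      simp [BimodTensor.incA, incM, ← map_add]
    rw [this, add_mul]
    exact add _ _ (incA_mul _ _ hz) (incM_mul _ _ hz)
  | mul x y hx hy => intro z hz; rw [map_mul, mul_assoc]; exact hx _ (hy _ hz)
  | add x y hx hy => intro z hz; rw [map_add, add_mul]; exact add _ _ (hx _ hz) (hy _ hz)

/-- Every element of `T_A(M)` is a sum of words in the basis. -/
theorem isHom_unit [IsScalarTower R (Env R A) M] (b : Module.Basis B (Env R A) M)
    (u : Unit) (x : BimodTensor R A M) : IsHom b (fun _ => ()) u x := by
  induction x using BimodTensor.induction_left with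
  | add x y hx hy => exact hx.add hy
  | incA a => exact .incA a
  | incA_mul a x hx => exact hx.incA_mul a
  | incM_mul m x hx =>
    refine IsHom.mul (g := ()) (g' := ()) (IsHom.of_mem_span (s := Set.range b) ?_ (b.mem_span m)) hx
    rintro _ ⟨c, rfl⟩
    exact isHom_basis (deg := fun _ => ()) c

end Homogeneous

/-! ### Adjoints with respect to the pairing. -/

section Adjoint

variable {R A M B : Type*} [CommRing R] [Ring A] [Algebra R A] [AddCommGroup M] [Module R M]
  [Module (Env R A) M] [IsScalarTower R (Env R A) M] (b : Module.Basis B (Env R A) M)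
  (H : HermitianAlgebra R A)

theorem HermitianAlgebra.t_mul_left' (a p x : A) : H.t a (p * x) = H.t (H.star p * a) x := by
  rw [H.t_mul_left, H.star_star]

theorem HermitianAlgebra.t_mul_right' (a p x : A) : H.t a (x * p) = H.t (a * H.star p) x := by
  rw [H.t_mul_right, H.star_star]

theorem HermitianAlgebra.t_mul_mul (a p x : A) : H.t a (p * x) = H.t (a * H.star x) p :=
  H.t_mul_right' a x p

/-- Words with different degrees are orthogonal. -/
theorem pairing_eq_zero_of_isHom {Γ : Type*} [AddMonoid Γ] {deg : B → Γ} {g g' : Γ} (hg : g ≠ g')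
    {x y : BimodTensor R A M} (hx : IsHom b deg g x) (hy : IsHom b deg g' y) :
    pairing b H x y = 0 := by
  classical
  induction hx generalizing g' y with
  | zero g => simp
  | add _ _ h h' => rw [map_add, LinearMap.add_apply, h hg hy, h' hg hy, add_zero]
  | incA a =>
    induction hy with
    | zero => simp
    | add _ _ h h' => rw [map_add, h hg, h' hg, add_zero]
    | incA a' => exact absurd rfl hg
    | cons a' c _ _ => exact pairing_incA_cons b H _ _ _ _
  | @cons a c g x hx ih =>
    induction hy with
    | zero => simp
    | add _ _ h h' => rw [map_add, h hg, h' hg, add_zero]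
    | incA a' => exact pairing_cons_incA b H _ _ _ _
    | cons a' c' hy _ =>
      rw [pairing_cons_cons]
      split_ifs with hc
      · subst hc
        rw [ih (fun h => hg (by rw [h])) hy, mul_zero]
      · rfl

/-- Only the leftmost coefficients are affected, so this is the adjunction $\mathfrak
t(a,px)=\mathfrak t(p^\star a,x)$. -/
theorem pairing_incA_mul (p : A) (x y : BimodTensor R A M) :
    pairing b H x (incA R A M p * y) = pairing b H (incA R A M (H.star p) * x) y := by
  classical
  -- Grading by `Unit` imposes no condition, so induction on this predicate is induction over sums
  -- of words.
  obtain ⟨u, hx⟩ : ∃ u, IsHom b (fun _ => ()) u x := ⟨(), isHom_unit b _ x⟩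
  induction hx generalizing y with
  | zero g => simp
  | add _ _ h h' => simp only [mul_add, map_add, LinearMap.add_apply, h, h']
  | incA a =>
    obtain ⟨u, hy⟩ : ∃ u, IsHom b (fun _ => ()) u y := ⟨(), isHom_unit b _ y⟩
    induction hy with
    | zero => simp
    | add _ _ h h' => simp only [mul_add, map_add, h, h']
    | incA a' => rw [← map_mul, ← map_mul, pairing_incA_incA, pairing_incA_incA, H.t_mul_left']
    | cons a' c _ _ =>
      rw [← mul_assoc, ← mul_assoc, ← map_mul, ← map_mul, pairing_incA_cons, pairing_incA_cons]
  | @cons a c g x hx ih =>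
    obtain ⟨u, hy⟩ : ∃ u, IsHom b (fun _ => ()) u y := ⟨(), isHom_unit b _ y⟩
    induction hy with
    | zero => simp
    | add _ _ h h' => simp only [mul_add, map_add, h, h']
    | incA a' =>
      rw [← mul_assoc, ← mul_assoc, ← map_mul, ← map_mul, pairing_cons_incA, pairing_cons_incA]
    | cons a' c' hy _ =>
      rw [← mul_assoc, ← mul_assoc, ← map_mul, ← mul_assoc, ← mul_assoc, ← map_mul,
        pairing_cons_cons, pairing_cons_cons, H.t_mul_left']

theorem pairing_mul_incA (p : A) (x y : BimodTensor R A M) :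
    pairing b H x (y * incA R A M p) = pairing b H (x * incA R A M (H.star p)) y := by
  classical
  obtain ⟨u, hx⟩ : ∃ u, IsHom b (fun _ => ()) u x := ⟨(), isHom_unit b _ x⟩
  induction hx generalizing y with
  | zero g => simp
  | add _ _ h h' => simp only [add_mul, map_add, LinearMap.add_apply, h, h']
  | incA a =>
    obtain ⟨u, hy⟩ : ∃ u, IsHom b (fun _ => ()) u y := ⟨(), isHom_unit b _ y⟩
    induction hy with
    | zero => simp
    | add _ _ h h' => simp only [add_mul, map_add, h, h']
    | incA a' => rw [← map_mul, ← map_mul, pairing_incA_incA, pairing_incA_incA, H.t_mul_right']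
    | cons a' c _ _ => rw [mul_assoc, ← map_mul, pairing_incA_cons, pairing_incA_cons]
  | @cons a c g x hx ih =>
    obtain ⟨u, hy⟩ : ∃ u, IsHom b (fun _ => ()) u y := ⟨(), isHom_unit b _ y⟩
    induction hy with
    | zero => simp
    | add _ _ h h' => simp only [add_mul, map_add, h, h']
    | incA a' => rw [mul_assoc _ x, ← map_mul, pairing_cons_incA, pairing_cons_incA]
    | cons a' c' hy _ =>
      rw [mul_assoc _ _ (incA R A M p), mul_assoc _ _ (incA R A M (H.star p)), pairing_cons_cons,
        pairing_cons_cons, ih]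

/-- Factors of the same length on the left can be replaced by an element of `A`. -/
theorem exists_pairing_mul_mul {n : ℕ} {w y : BimodTensor R A M}
    (hw : IsHom b (fun _ => 1) n w) (hy : IsHom b (fun _ => 1) n y) :
    ∃ k : A, ∀ z z', pairing b H (w * z) (y * z') = pairing b H (incA R A M k * z) z' := by
  classical
  induction hw generalizing y with
  | zero n => exact ⟨0, by simp⟩
  | add _ _ h h' =>
    obtain ⟨k, hk⟩ := h hy
    obtain ⟨k', hk'⟩ := h' hy
    exact ⟨k + k', fun z z' => by simp only [add_mul, map_add, LinearMap.add_apply, hk, hk']⟩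
  | incA a =>
    generalize hn : (0 : ℕ) = n at hy
    induction hy with
    | zero => exact ⟨0, by simp⟩
    | add _ _ h h' =>
      obtain ⟨k, hk⟩ := h hn
      obtain ⟨k', hk'⟩ := h' hn
      exact ⟨k + k', fun z z' => by simp only [add_mul, map_add, LinearMap.add_apply, hk, hk']⟩
    | incA a' => exact ⟨H.star a' * a, fun z z' => by rw [pairing_incA_mul, ← mul_assoc, ← map_mul]⟩
    | cons a' c _ _ => omega
  | @cons a c n x hx ih =>
    generalize hn : 1 + n = n' at hy
    induction hy with
    | zero => exact ⟨0, by simp⟩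
    | add _ _ h h' =>
      obtain ⟨k, hk⟩ := h hn
      obtain ⟨k', hk'⟩ := h' hn
      exact ⟨k + k', fun z z' => by simp only [add_mul, map_add, LinearMap.add_apply, hk, hk']⟩
    | incA a' => omega
    | cons a' c' hy _ =>
      obtain rfl := Nat.add_left_cancel hn
      obtain ⟨k, hk⟩ := ih hy
      -- The scalar $\mathfrak t(a,a')$ comes from the leading letters, and $k$ from the remaining
      -- ones.
      refine ⟨if c = c' then H.t a a' • k else 0, fun z z' => ?_⟩
      rw [mul_assoc, mul_assoc _ _ z', pairing_cons_cons, hk]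
      split_ifs <;> simp

/-- The pairing of two words of the same positive length, as a function of the outermost
coefficients of one of them, is represented by an element of the enveloping algebra. -/
theorem exists_pairing_env [DecidableEq B] {n : ℕ} (hn : 1 ≤ n) {w y : BimodTensor R A M}
    (hw : IsHom b (fun _ => 1) n w) (hy : IsHom b (fun _ => 1) n y) :
    ∃ u : Env R A, ∀ c p q, pairing b H w (incA R A M p * y * incA R A M q) =
      pairing b H (incM R A M (u • b c)) (incM R A M ((p ⊗ₜ[R] op q) • b c)) := by
  induction hw generalizing y with
  | zero n =>
    refine ⟨0, fun c p q => ?_⟩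
    have : (0 : Env R A) • b c = 0 := zero_smul (Env R A) (b c)
    simp [this]
  | add _ _ h h' =>
    obtain ⟨k, hk⟩ := h hn hy
    obtain ⟨k', hk'⟩ := h' hn hy
    exact ⟨k + k', fun c p q => by
      simp only [add_smul, map_add, LinearMap.add_apply, hk c, hk' c]⟩
  | incA a => omega
  | @cons a c n x hx ih =>
    generalize hn' : 1 + n = n' at hy
    induction hy with
    | zero =>
      refine ⟨0, fun c p q => ?_⟩
      have : (0 : Env R A) • b c = 0 := zero_smul (Env R A) (b c)
      simp [this]
    | add _ _ h h' =>
      obtain ⟨k, hk⟩ := h hn'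
      obtain ⟨k', hk'⟩ := h' hn'
      exact ⟨k + k', fun c p q => by
        simp only [add_smul, map_add, LinearMap.add_apply, mul_add, add_mul, hk c, hk' c]⟩
    | incA a' => omega
    | @cons a' c' n'' x' hy _ =>
      obtain rfl := Nat.add_left_cancel hn'
      obtain ⟨k, hk⟩ := exists_pairing_mul_mul b H hx hy
      -- Here $p$ and $q$ separate: $\langle a\,c\,x, p\,a'c\,x'q\rangle=\mathfrak t(a,pa')\langle
      -- x,x'q\rangle=\mathfrak t(aa'^\star,p)\,\mathfrak t(k,q)$. A letter is needed between $p$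
      -- and $q$, hence $n\ge1$.
      refine ⟨if c = c' then (a * H.star a') ⊗ₜ[R] op k else 0, fun c'' p q => ?_⟩
      have hk' := hk 1 (incA R A M q)
      rw [mul_one, mul_one, pairing_incA_incA] at hk'
      rw [← mul_assoc, ← mul_assoc, ← map_mul, mul_assoc _ _ (incA R A M q), pairing_cons_cons, hk']
      split_ifs with hc
      · rw [incM_env_smul, incM_env_smul, pairing_cons_cons, if_pos rfl, pairing_incA_incA,
          H.t_mul_mul]
      · have : (0 : Env R A) • b c'' = 0 := zero_smul (Env R A) (b c'')
        simp [this]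

/-- A morphism of bimodules `M → M^{⊠ n}` with `n ≥ 1` has a unique adjoint. -/
theorem existsUnique_isAdjoint [Finite B] {n : ℕ} (hn : 1 ≤ n) (f : M →ₗ[R] BimodTensor R A M)
    (hf : ∀ (z : Env R A) m, f (z • m) = z • f m)
    (hlen : ∀ m, IsHom b (fun _ => 1) n (f m)) :
    ∃! ν : boxPow R A M n →ₗ[Env R A] M, IsAdjoint b H f ν := by
  classical
  have : Fintype B := Fintype.ofFinite B
  have key : ∀ w : boxPow R A M n, ∃ u : M, ∀ x : M,
      pairing b H w (f x) = pairing b H (incM R A M u) (incM R A M x) := by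
    intro w
    have hw := isHom_of_mem_boxPow b w.2
    choose u hu using fun c => exists_pairing_env b H hn hw (hlen (b c))
    -- The coefficient at $c$ is prescribed by the values of the functional on $p\,c\,q$; other
    -- basis elements are orthogonal to these.
    refine ⟨∑ c, u c • b c, fun x => ?_⟩
    induction x using basis_induction b with
    | h0 => simp
    | hadd x y hx hy => simp only [map_add, hx, hy]
    | hb p q c =>
      rw [hf, tmul_smul, ← mul_assoc, hu c c p q, map_sum, map_sum, LinearMap.sum_apply,
        Finset.sum_eq_single c]
      · intro c' _ hc'
        rw [pairing_env_smul, if_neg hc']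
      · simp
  choose ν hν using key
  have hsmul : ∀ (p q : A) (w : boxPow R A M n), ν ((p ⊗ₜ[R] op q) • w) =
      (p ⊗ₜ[R] op q) • ν w := by
    intro p q w
    refine eq_of_pairing b H _ _ fun x => ?_
    -- Testing $w$ against $p^\star x q^\star$ and moving the coefficients across the pairing
    -- identifies $\nu(pwq)$ with $p\,\nu(w)\,q$.
    have h := hν w ((H.star p ⊗ₜ[R] op (H.star q)) • x)
    rw [hf, tmul_smul, pairing_incA_mul, pairing_mul_incA, incM_env_smul, pairing_mul_incA,
      pairing_incA_mul, H.star_star, H.star_star] at h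
    rw [← hν, incM_env_smul, Submodule.coe_smul, tmul_smul, ← mul_assoc, h, mul_assoc]
  have hadd : ∀ v w, ν (v + w) = ν v + ν w := fun v w =>
    eq_of_pairing b H _ _ fun x => by
      rw [← hν, Submodule.coe_add, map_add, map_add, map_add, LinearMap.add_apply,
        LinearMap.add_apply, hν, hν]
  refine ⟨⟨⟨ν, hadd⟩, fun z w => ?_⟩, fun w => LinearMap.ext fun x => hν w x, fun ν' h => ?_⟩
  · change ν (z • w) = z • ν w
    induction z using TensorProduct.induction_on with
    | zero =>
      have h0 : (0 : Env R A) • w = 0 := zero_smul (Env R A) w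
      have h1 : (0 : Env R A) • ν w = 0 := zero_smul (Env R A) (ν w)
      rw [h0, h1]
      simpa using hadd 0 0
    | tmul p q =>
      obtain ⟨q, rfl⟩ := MulOpposite.op_surjective q
      exact hsmul p q w
    | add y z hy hz => rw [add_smul, add_smul, hadd, hy, hz]
  · ext w
    refine eq_of_pairing b H _ _ fun x => ?_
    exact (LinearMap.congr_fun (h w) x).symm.trans (hν w x)

/-- The defining property of an adjoint holds with further factors on the right. -/
theorem IsAdjoint.exists_pairing {n : ℕ} {f : M →ₗ[R] BimodTensor R A M}
    {ν : boxPow R A M n →ₗ[Env R A] M} (h : IsAdjoint b H f ν)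
    (hf : ∀ (z : Env R A) m, f (z • m) = z • f m)
    (hlen : ∀ m, IsHom b (fun _ => 1) n (f m)) (w : boxPow R A M n) (m : M) :
    ∃ k : A, (∀ z z', pairing b H (incM R A M (ν w) * z) (incM R A M m * z') =
        pairing b H z (incA R A M k * z')) ∧
      ∀ z z', pairing b H (w * z) (f m * z') = pairing b H z (incA R A M k * z') := by
  obtain ⟨k, hk⟩ := exists_pairing_mul_mul b H (isHom_length_incM b (ν w)) (isHom_length_incM b m)
  obtain ⟨k', hk'⟩ := exists_pairing_mul_mul b H (isHom_of_mem_boxPow b w.2) (hlen m)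
  -- With $z=1$ and $z'=x\in A$ both sides are values of the defining equation of the adjoint at
  -- $m\,x$, so the two coefficients agree by nondegeneracy for $n=1$.
  have hkk : k = k' := t_nondegenerate H _ _ fun x => by
    have h1 := hk 1 (incA R A M x)
    have h2 := hk' 1 (incA R A M x)
    have h3 := LinearMap.congr_fun (h w) (((1 : A) ⊗ₜ[R] op x) • m)
    rw [LinearMap.dualMap_apply, LinearMap.dualMap_apply, hf, ← incM_mul_incA, tmul_smul, map_one,
      one_mul] at h3
    rw [mul_one, mul_one, pairing_incA_incA] at h1 h2
    rw [← h1, ← h2, h3]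
  subst hkk
  refine ⟨H.star k, fun z z' => ?_, fun z z' => ?_⟩
  · rw [hk, pairing_incA_mul, H.star_star]
  · rw [hk', pairing_incA_mul, H.star_star]

end Adjoint

/-! ### Insertion of augmentations as sums over monotone paths. -/

section Path

variable {R A M B : Type*} [CommRing R] [Ring A] [Algebra R A] [AddCommGroup M] [Module R M]
  [Module (Env R A) M] {μ : ℕ} [IsScalarTower R (Env R A) M] {b : Module.Basis B (Env R A) M}
  {deg : B → ZMod (2 * μ)} {D : SemifreeDGA b deg}

/-- The inclusion of `M` in `T_A(M)` as a morphism of bimodules. -/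
def incMEnv (R A M : Type*) [CommRing R] [Ring A] [Algebra R A] [AddCommGroup M] [Module R M]
    [Module (Env R A) M] : M →ₗ[Env R A] BimodTensor R A M where
  toFun := incM R A M
  map_add' := map_add _
  map_smul' := incM_smul

omit [IsScalarTower R (Env R A) M] in
theorem incMEnv_apply (m : M) : incMEnv R A M m = incM R A M m := rfl

omit [IsScalarTower R (Env R A) M] in
theorem Augmentation.map_left (ε : Augmentation D) (a : A) (m : M) :
    ε.toAlgHom (incM R A M ((a ⊗ₜ[R] (1 : Aᵐᵒᵖ)) • m)) = a * ε.toAlgHom (incM R A M m) := by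
  rw [← incA_mul_incM, map_mul, ε.map_incA]

omit [IsScalarTower R (Env R A) M] in
theorem Augmentation.map_right (ε : Augmentation D) (a : A) (m : M) :
    ε.toAlgHom (incM R A M (((1 : A) ⊗ₜ[R] op a) • m)) = ε.toAlgHom (incM R A M m) * a := by
  rw [← incM_mul_incA, map_mul, ε.map_incA]

/-- The operator `v ↦ (εᵢ(m) vᵢ + wᵢ(m) vᵢ₊₁)ᵢ` on sequences in `T_A(M)`. -/
def stepMap (ε : ℕ → Augmentation D) (w : ℕ → M →ₗ[Env R A] BimodTensor R A M) :
    M →ₗ[R] Module.End R (ℕ → BimodTensor R A M) :=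
  LinearMap.mk₂ R
    (fun m v i => incA R A M ((ε i).toAlgHom (incM R A M m)) * v i + w i m * v (i + 1))
    (fun m m' v => by ext i; simp only [map_add, add_mul, Pi.add_apply]; abel)
    (fun r m v => by
      ext i
      simp only [map_smul, (w i).map_smul_of_tower, smul_mul_assoc, Pi.smul_apply, smul_add])
    (fun m v v' => by ext i; simp only [Pi.add_apply, mul_add]; abel)
    (fun r m v => by ext i; simp only [Pi.smul_apply, mul_smul_comm, smul_add])

theorem stepMap_apply (ε : ℕ → Augmentation D) (w : ℕ → M →ₗ[Env R A] BimodTensor R A M)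
    (m : M) (v : ℕ → BimodTensor R A M) (i : ℕ) :
    stepMap ε w m v i =
      incA R A M ((ε i).toAlgHom (incM R A M m)) * v i + w i m * v (i + 1) := rfl

/-- The action of `T_A(M)` on sequences for which `m ∈ M` acts by `stepMap`. -/
def stepHom (ε : ℕ → Augmentation D) (w : ℕ → M →ₗ[Env R A] BimodTensor R A M) :
    BimodTensor R A M →ₐ[R] Module.End R (ℕ → BimodTensor R A M) :=
  BimodTensor.lift ((Algebra.lsmul R R (ℕ → BimodTensor R A M)).comp (incA R A M)) (stepMap ε w)
    (fun a m => by
      ext v i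
      rw [stepMap_apply, Augmentation.map_left, map_smul, ← MulOpposite.op_one, tmul_smul]
      simp [stepMap_apply, mul_add, mul_assoc])
    (fun a m => by
      ext v i
      rw [stepMap_apply, Augmentation.map_right, map_smul, tmul_smul]
      simp [stepMap_apply, mul_assoc])

/-- The sum over the monotone paths from `i` to `n`, where staying at `j` contributes `εⱼ(m)` and
going from `j` to `j + 1` contributes `wⱼ(m)`. -/
def path (ε : ℕ → Augmentation D) (w : ℕ → M →ₗ[Env R A] BimodTensor R A M) (i n : ℕ) :
    BimodTensor R A M →ₗ[R] BimodTensor R A M :=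
  LinearMap.proj i ∘ₗ LinearMap.applyₗ (Pi.single n 1) ∘ₗ (stepHom ε w).toLinearMap

variable (ε : ℕ → Augmentation D) (w : ℕ → M →ₗ[Env R A] BimodTensor R A M)

theorem path_incA (i n : ℕ) (a : A) :
    path ε w i n (incA R A M a) = if i = n then incA R A M a else 0 := by
  simp [path, stepHom, lift_incA, Pi.single_apply]

theorem path_incA_mul (i n : ℕ) (a : A) (x : BimodTensor R A M) :
    path ε w i n (incA R A M a * x) = incA R A M a * path ε w i n x := by
  simp [path, stepHom, lift_incA]

theorem path_incM_mul (i n : ℕ) (m : M) (x : BimodTensor R A M) :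
    path ε w i n (incM R A M m * x) =
      incA R A M ((ε i).toAlgHom (incM R A M m)) * path ε w i n x +
        w i m * path ε w (i + 1) n x := by
  simp only [path, stepHom, LinearMap.comp_apply, AlgHom.toLinearMap_apply, map_mul, lift_incM,
    LinearMap.applyₗ_apply_apply, Module.End.mul_apply, LinearMap.proj_apply, stepMap_apply]

theorem path_mul_incA (i n : ℕ) (a : A) (x : BimodTensor R A M) :
    path ε w i n (x * incA R A M a) = path ε w i n x * incA R A M a := by
  induction x using BimodTensor.induction_left generalizing i with
  | add x y hx hy => simp only [add_mul, map_add, hx, hy]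
  | incA a' =>
    rw [← map_mul, path_incA, path_incA]
    split_ifs <;> simp
  | incA_mul a' x hx => rw [mul_assoc, path_incA_mul, path_incA_mul, hx, mul_assoc]
  | incM_mul m x hx =>
    rw [mul_assoc, path_incM_mul, path_incM_mul, hx, hx, add_mul, mul_assoc, mul_assoc]

theorem path_smul (i n : ℕ) (z : Env R A) (x : BimodTensor R A M) :
    path ε w i n (z • x) = z • path ε w i n x := by
  induction z using TensorProduct.induction_on with
  | zero =>
    have h (y : BimodTensor R A M) : (0 : Env R A) • y = 0 := zero_smul (Env R A) y
    rw [h, h, map_zero]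
  | tmul a a' =>
    obtain ⟨a', rfl⟩ := MulOpposite.op_surjective a'
    rw [tmul_smul, tmul_smul, path_incA_mul, path_mul_incA]
  | add y z hy hz => rw [add_smul, add_smul, map_add, hy, hz]

theorem path_eq_zero {i n : ℕ} (h : n < i) (x : BimodTensor R A M) : path ε w i n x = 0 := by
  induction x using BimodTensor.induction_left generalizing i with
  | add x y hx hy => rw [map_add, hx h, hy h, add_zero]
  | incA a => rw [path_incA, if_neg (by omega)]
  | incA_mul a x hx => rw [path_incA_mul, hx h, mul_zero]
  | incM_mul m x hx => rw [path_incM_mul, hx h, hx (by omega), mul_zero, mul_zero, add_zero]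

theorem path_self (i : ℕ) (x : BimodTensor R A M) :
    path ε w i i x = incA R A M ((ε i).toAlgHom x) := by
  induction x using BimodTensor.induction_left with
  | add x y hx hy => simp only [map_add, hx, hy]
  | incA a => rw [path_incA, if_pos rfl, (ε i).map_incA]
  | incA_mul a x hx => rw [path_incA_mul, hx, map_mul, map_mul, (ε i).map_incA]
  | incM_mul m x hx =>
    rw [path_incM_mul, hx, path_eq_zero ε w (Nat.lt_succ_self i), mul_zero, add_zero, map_mul,
      map_mul]

-- Paths never descend, so only the data at indices $\ge i$ enter and these may be renumbered.
-- Sequences indexed by $\mathbb N$ make this possible without boundary conditions.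
variable {ε w} in
theorem path_shift {ε' : ℕ → Augmentation D} {w' : ℕ → M →ₗ[Env R A] BimodTensor R A M} {i r : ℕ}
    (hε : ∀ j, i ≤ j → ε j = ε' (j + r)) (hw : ∀ j, i ≤ j → w j = w' (j + r)) (n : ℕ)
    (x : BimodTensor R A M) : path ε w i n x = path ε' w' (i + r) (n + r) x := by
  induction x using BimodTensor.induction_left generalizing i with
  | add x y hx hy => rw [map_add, map_add, hx hε hw, hy hε hw]
  | incA a => simp [path_incA]
  | incA_mul a x hx => rw [path_incA_mul, path_incA_mul, hx hε hw]
  | incM_mul m x hx =>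
    rw [path_incM_mul, path_incM_mul, hx hε hw, hε i le_rfl, hw i le_rfl,
      hx (fun j hj => hε j (by omega)) (fun j hj => hw j (by omega)), Nat.add_right_comm]

/-- A path is cut at the level $j$ reached after reading $x$; levels below $i$ contribute zero. -/
theorem path_mul (i n : ℕ) (x y : BimodTensor R A M) :
    path ε w i n (x * y) =
      ∑ j ∈ Finset.range (n + 1), path ε w i j x * path ε w j n y := by
  induction x using BimodTensor.induction_left generalizing i with
  | add x x' hx hx' => simp only [add_mul, map_add, hx, hx', Finset.sum_add_distrib]
  | incA a =>
    rw [path_incA_mul]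
    simp only [path_incA, ite_mul, zero_mul, Finset.sum_ite_eq, Finset.mem_range]
    split_ifs with h
    · rfl
    · rw [path_eq_zero ε w (by omega), mul_zero]
  | incA_mul a x hx => simp only [mul_assoc, path_incA_mul, hx, Finset.mul_sum]
  | incM_mul m x hx =>
    simp only [mul_assoc, path_incM_mul, hx, Finset.mul_sum, add_mul, Finset.sum_add_distrib]

theorem path_isHom_length (i l : ℕ) (x : BimodTensor R A M) :
    IsHom b (fun _ => 1) l (path ε (fun _ => incMEnv R A M) i (i + l) x) := by
  induction x using BimodTensor.induction_left generalizing i l with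
  | add x y hx hy => rw [map_add]; exact (hx i l).add (hy i l)
  | incA a =>
    rw [path_incA]
    split_ifs with h
    · obtain rfl : l = 0 := by omega
      exact .incA a
    · exact .zero _
  | incA_mul a x hx => rw [path_incA_mul]; exact (hx i l).incA_mul a
  | incM_mul m x hx =>
    rw [path_incM_mul]
    refine ((hx i l).incA_mul _).add ?_
    rcases l with _ | l
    · rw [path_eq_zero _ _ (by omega), mul_zero]
      exact .zero _
    · rw [show i + (l + 1) = i + 1 + l by omega, add_comm l 1]
      exact (isHom_length_incM b m).mul (hx (i + 1) l)

/-- A letter replaced by its augmentation either has degree $0$ or contributes zero, so the total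
degree is kept. -/
theorem path_isHom_degree (i n : ℕ) {g : ZMod (2 * μ)} {x : BimodTensor R A M}
    (hx : IsHom b deg g x) : IsHom b deg g (path ε (fun _ => incMEnv R A M) i n x) := by
  induction hx generalizing i with
  | zero g => rw [map_zero]; exact .zero g
  | add _ _ hx hy => rw [map_add]; exact (hx i).add (hy i)
  | incA a =>
    rw [path_incA]
    split_ifs with h
    · exact .incA a
    · exact .zero _
  | @cons a c g x hx ih =>
    rw [mul_assoc, path_incA_mul, path_incM_mul]
    refine IsHom.incA_mul (.add ?_ ((isHom_basis c).mul (ih _))) a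
    by_cases hc : deg c = 0
    · rw [hc, zero_add]
      exact (ih i).incA_mul _
    · rw [(ε i).map_degree (deg c) hc, map_zero, zero_mul]
      · exact .zero _
      · exact Submodule.subset_span ⟨1, fun _ => b c, fun _ => deg c,
          fun _ => Submodule.subset_span ⟨c, rfl, rfl⟩, by simp, by simp⟩

theorem insertHom_apply {n : ℕ} (x : BimodTensor R A M) (i j : Fin (n + 1)) :
    insertHom (fun t : Fin (n + 1) => ε t) x i j = path ε (fun _ => incMEnv R A M) i j x := by
  induction x using BimodTensor.induction_left generalizing i with
  | add x y hx hy => rw [map_add, map_add, Matrix.add_apply, hx, hy]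
  | incA a => simp [insertHom, lift_incA, path_incA, Matrix.diagonal_apply, Fin.ext_iff]
  | incA_mul a x hx => rw [map_mul, path_incA_mul, ← hx]; simp [insertHom, lift_incA]
  | incM_mul m x hx =>
    rw [map_mul, path_incM_mul, Matrix.mul_apply]
    simp only [hx]
    rw [insertHom, lift_incM]
    have h (k : Fin (n + 1)) : insertMatrix (fun t : Fin (n + 1) => ε t) m i k *
        path ε (fun _ => incMEnv R A M) k j x =
          (if i = k then incA R A M ((ε i).toAlgHom (incM R A M m)) *
            path ε (fun _ => incMEnv R A M) k j x else 0) +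
          (if (i : ℕ) + 1 = k then incM R A M m * path ε (fun _ => incMEnv R A M) k j x else 0) := by
      simp only [insertMatrix, LinearMap.coe_mk, AddHom.coe_mk, Matrix.of_apply]
      by_cases hik : i = k
      · subst hik; simp
      · simp [hik]
    rw [Finset.sum_congr rfl fun k _ => h k, Finset.sum_add_distrib, Finset.sum_ite_eq,
      if_pos (Finset.mem_univ _),
      Fin.sum_univ_eq_sum_range (fun k => if (i : ℕ) + 1 = k then
        incM R A M m * path ε (fun _ => incMEnv R A M) k j x else 0), Finset.sum_ite_eq]
    congr 1
    split_ifs with hi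
    · rfl
    -- At the last row the step upwards leaves the matrix; the corresponding path starts above its
    -- endpoint.
    · rw [path_eq_zero, mul_zero]
      have := Finset.mem_range.not.1 hi
      omega

theorem insertAug_apply {n : ℕ} (x : BimodTensor R A M) :
    insertAug (fun t : Fin (n + 1) => ε t) x = path ε (fun _ => incMEnv R A M) 0 n x :=
  insertHom_apply ε x 0 (Fin.last n)

/-- The component `M → M^{⊠ (n - i)}` of the differential deformed by the augmentations
`εᵢ, …, εₙ`. -/
def augComponent (i n : ℕ) : M →ₗ[Env R A] BimodTensor R A M where
  toFun m := path ε (fun _ => incMEnv R A M) i n (D.d (incM R A M m))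
  map_add' x y := by simp only [map_add]
  map_smul' z x := by simp only [incM_smul, map_smul, path_smul, RingHom.id_apply]

theorem augComponent_apply (i n : ℕ) (m : M) : augComponent ε i n m =
    path ε (fun _ => incMEnv R A M) i n (D.d (incM R A M m)) := rfl

theorem deformedComponent_apply {n : ℕ} (m : M) :
    deformedComponent (fun t : Fin (n + 1) => ε t) m = augComponent ε 0 n m :=
  insertAug_apply ε _

theorem deformedComponent_shift (i l : ℕ) (m : M) :
    deformedComponent (fun t : Fin (l + 1) => ε (i + t)) m = augComponent ε i (i + l) m := by
  rw [deformedComponent_apply (fun t => ε (i + t)), augComponent_apply, augComponent_apply,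
    path_shift (ε' := ε) (w' := fun _ => incMEnv R A M) (r := i) (fun j _ => by rw [add_comm])
      (fun _ _ => rfl), zero_add, add_comm]

end Path

/-! ### The projections to fixed length. -/

section Length

variable {R A M B : Type*} [CommRing R] [Ring A] [Algebra R A] [AddCommGroup M] [Module R M]
  [Module (Env R A) M]

theorem lengthProj_incA (n : ℕ) (a : A) :
    lengthProj R A M n (incA R A M a) = if n = 0 then incA R A M a else 0 := by
  simp [lengthProj, lengthHom, lift_incA, Polynomial.coeff_C]

theorem lengthProj_incA_mul (n : ℕ) (a : A) (x : BimodTensor R A M) :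
    lengthProj R A M n (incA R A M a * x) = incA R A M a * lengthProj R A M n x := by
  simp [lengthProj, lengthHom, lift_incA]

theorem lengthProj_mul_incA (n : ℕ) (a : A) (x : BimodTensor R A M) :
    lengthProj R A M n (x * incA R A M a) = lengthProj R A M n x * incA R A M a := by
  simp [lengthProj, lengthHom, lift_incA]

theorem lengthProj_smul (n : ℕ) (z : Env R A) (x : BimodTensor R A M) :
    lengthProj R A M n (z • x) = z • lengthProj R A M n x := by
  induction z using TensorProduct.induction_on with
  | zero =>
    have h (y : BimodTensor R A M) : (0 : Env R A) • y = 0 := zero_smul (Env R A) y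
    rw [h, h, map_zero]
  | tmul a a' =>
    obtain ⟨a', rfl⟩ := MulOpposite.op_surjective a'
    rw [tmul_smul, tmul_smul, lengthProj_incA_mul, lengthProj_mul_incA]
  | add y z hy hz => rw [add_smul, add_smul, map_add, hy, hz]

theorem lengthProj_incM_mul_zero (m : M) (x : BimodTensor R A M) :
    lengthProj R A M 0 (incM R A M m * x) = 0 := by
  simp [lengthProj, lengthHom, lift_incM, Polynomial.mul_coeff_zero, Polynomial.coeff_monomial]

theorem lengthProj_incM_mul_succ (n : ℕ) (m : M) (x : BimodTensor R A M) :
    lengthProj R A M (n + 1) (incM R A M m * x) = incM R A M m * lengthProj R A M n x := by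
  simp [lengthProj, lengthHom, lift_incM, ← Polynomial.C_mul_X_eq_monomial, mul_assoc]

theorem lengthProj_isHom [IsScalarTower R (Env R A) M] (b : Module.Basis B (Env R A) M) (n : ℕ)
    (x : BimodTensor R A M) : IsHom b (fun _ => 1) n (lengthProj R A M n x) := by
  induction x using BimodTensor.induction_left generalizing n with
  | add x y hx hy => rw [map_add]; exact (hx n).add (hy n)
  | incA a =>
    rw [lengthProj_incA]
    split_ifs with h
    · subst h; exact .incA a
    · exact .zero _
  | incA_mul a x hx => rw [lengthProj_incA_mul]; exact (hx n).incA_mul a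
  | incM_mul m x hx =>
    rcases n with _ | n
    · rw [lengthProj_incM_mul_zero]; exact .zero _
    · rw [lengthProj_incM_mul_succ, add_comm n 1]; exact (isHom_length_incM b m).mul (hx n)

end Length

/-! ### Signs and the Leibniz rule for inhomogeneous elements. -/

section Sign

variable {R A M B : Type*} [CommRing R] [Ring A] [Algebra R A] [AddCommGroup M] [Module R M]
  [Module (Env R A) M] {μ : ℕ} (b : Module.Basis B (Env R A) M) (deg : B → ZMod (2 * μ))

theorem neg_one_pow_natAbs_add (g h : ℤ) :
    (-1 : ℤ) ^ (g + h).natAbs = (-1) ^ (g.natAbs + h.natAbs) := by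
  have : (g + h).natAbs % 2 = (g.natAbs + h.natAbs) % 2 := by omega
  rw [neg_one_pow_eq_pow_mod_two, this, ← neg_one_pow_eq_pow_mod_two]

/-- The modulus is even, so representatives have a well-defined parity; for $\mu=0$ the
representative is the absolute value of an integer. -/
theorem neg_one_pow_val_add (g h : ZMod (2 * μ)) :
    (-1 : ℤ) ^ (g + h).val = (-1) ^ g.val * (-1) ^ h.val := by
  rw [← pow_add]
  rcases μ with _ | μ
  · exact neg_one_pow_natAbs_add g h
  · have : NeZero (2 * (μ + 1)) := ⟨by omega⟩
    rw [ZMod.val_add, neg_one_pow_eq_pow_mod_two, Nat.mod_mul_right_mod,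
      ← neg_one_pow_eq_pow_mod_two]

theorem neg_one_pow_val_sub_one (g : ZMod (2 * μ)) :
    (-1 : ℤ) ^ (g - 1).val = -(-1) ^ g.val := by
  have h1 : (-1 : ℤ) ^ (1 : ZMod (2 * μ)).val = -1 := by
    rcases μ with _ | μ
    · rfl
    · rw [ZMod.val_one'' (by omega), pow_one]
  have := neg_one_pow_val_add (g - 1) 1
  rw [sub_add_cancel, h1] at this
  rw [this, mul_neg_one, neg_neg]

/-- Converts the Leibniz signs, given by unsuspended degrees, into the sign $(-1)^\dagger$ for
suspended ones. -/
theorem prod_neg_one_pow_val_sub_one (g : ℕ → ZMod (2 * μ)) (i : ℕ) :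
    ∏ t ∈ Finset.range i, (-1 : ℤ) ^ (g t - 1).val =
      (-1) ^ ((∑ t ∈ Finset.range i, g t).val + i) := by
  induction i with
  | zero => simp
  | succ i ih =>
    rw [Finset.prod_range_succ, ih, Finset.sum_range_succ, pow_add, pow_add, neg_one_pow_val_add,
      neg_one_pow_val_sub_one, pow_succ]
    ring

/-- The bimodule automorphism of `M` that multiplies the homogeneous elements of odd degree
by `-1`. -/
def signM : M →ₗ[Env R A] M := b.constr ℕ fun c => (-1 : ℤ) ^ (deg c).val • b c

omit [Module R M] in
theorem signM_basis (c : B) : signM b deg (b c) = (-1 : ℤ) ^ (deg c).val • b c :=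
  b.constr_basis ℕ _ c

omit [Module R M] in
theorem signM_of_mem_gradeM {g : ZMod (2 * μ)} {m : M} (hm : m ∈ gradeM b deg g) :
    signM b deg m = (-1 : ℤ) ^ g.val • m := by
  induction hm using Submodule.span_induction with
  | mem m h => obtain ⟨c, rfl, rfl⟩ := h; exact signM_basis b deg c
  | zero => simp
  | add x y _ _ hx hy => rw [map_add, hx, hy, smul_add]
  | smul z x _ hx => rw [map_smul, hx, smul_comm]

variable [IsScalarTower R (Env R A) M]

/-- Leading letters pair nontrivially only if they coincide, and then carry the same sign. -/
theorem pairing_signM (H : HermitianAlgebra R A) (m m' : M) (z z' : BimodTensor R A M) :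
    pairing b H (incM R A M (signM b deg m) * z) (incM R A M m' * z') =
      pairing b H (incM R A M m * z) (incM R A M (signM b deg m') * z') := by
  classical
  induction m using basis_induction b with
  | h0 => simp
  | hadd x y hx hy => simp only [map_add, add_mul, LinearMap.add_apply, hx, hy]
  | hb p q c =>
    induction m' using basis_induction b with
    | h0 => simp
    | hadd x y hx hy => simp only [map_add, add_mul, hx, hy]
    | hb p' q' c' =>
      simp only [map_smul, signM_basis, incM_env_smul, map_zsmul, mul_smul_comm, smul_mul_assoc,
        LinearMap.smul_apply, mul_assoc _ _ z, mul_assoc _ _ z', pairing_cons_cons]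
      split_ifs with h
      · rw [h]
      · simp

variable {b deg} (D : SemifreeDGA b deg)

/-- Augmentations see only degree $0$, where the sign is trivial. Thus Leibniz signs survive only on
retained factors. -/
theorem Augmentation.map_signM {D : SemifreeDGA b deg} (ε : Augmentation D) (m : M) :
    ε.toAlgHom (incM R A M (signM b deg m)) = ε.toAlgHom (incM R A M m) := by
  induction m using basis_induction b with
  | h0 => simp
  | hadd x y hx hy => simp only [map_add, hx, hy]
  | hb p q c =>
    rw [map_smul, signM_basis, incM_env_smul, incM_env_smul, map_mul, map_mul, map_mul, map_mul]
    congr 2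
    by_cases hc : deg c = 0
    · simp [hc]
    · rw [map_zsmul, map_zsmul, ε.map_degree (deg c) hc, smul_zero]
      exact Submodule.subset_span ⟨1, fun _ => b c, fun _ => deg c,
        fun _ => Submodule.subset_span ⟨c, rfl, rfl⟩, by simp, by simp⟩

omit [IsScalarTower R (Env R A) M] in
theorem SemifreeDGA.d_incA_mul (a : A) (x : BimodTensor R A M) :
    D.d (incA R A M a * x) = incA R A M a * D.d x := by
  have h (y : BimodTensor R A M) : incA R A M a * y = (a ⊗ₜ[R] op (1 : A)) • y := by
    rw [tmul_smul, map_one, mul_one]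
  rw [h, h, map_smul]

omit [IsScalarTower R (Env R A) M] in
theorem SemifreeDGA.d_one : D.d 1 = 0 := by
  -- The Leibniz rule for $1\cdot1$ reads $\partial1=\partial1+\partial1$.
  have := D.leibniz 0 1 (Submodule.subset_span ⟨0, 0, 0, by simp, by simp, by simp⟩) 1
  simpa using this

omit [IsScalarTower R (Env R A) M] in
theorem SemifreeDGA.d_incA (a : A) : D.d (incA R A M a) = 0 := by
  rw [← mul_one (incA R A M a), D.d_incA_mul, D.d_one, mul_zero]

theorem SemifreeDGA.d_incM_mul (m : M) (x : BimodTensor R A M) :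
    D.d (incM R A M m * x) =
      D.d (incM R A M m) * x + incM R A M (signM b deg m) * D.d x := by
  induction m using basis_induction b with
  | h0 => simp
  | hadd y z hy hz => simp only [map_add, add_mul, hy, hz]; abel
  | hb p q c =>
    have h := D.leibniz (deg c) (incM R A M (b c)) (Submodule.subset_span ⟨1, fun _ => b c,
      fun _ => deg c, fun _ => Submodule.subset_span ⟨c, rfl, rfl⟩, by simp, by simp⟩)
    rw [(signM b deg).map_smul, signM_basis, incM_smul, map_smul, tmul_smul, tmul_smul, incM_env_smul,
      mul_assoc, mul_assoc, mul_assoc, mul_assoc, D.d_incA_mul, h, D.d_incA_mul, mul_add]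
    congr 1
    rw [map_zsmul, zsmul_eq_mul]
    push_cast
    simp only [mul_assoc]

end Sign

/-! ### The Leibniz rule and adjoints for path sums. -/

section Derivation

variable {R A M B : Type*} [CommRing R] [Ring A] [Algebra R A] [AddCommGroup M] [Module R M]
  [Module (Env R A) M] {μ : ℕ} [IsScalarTower R (Env R A) M] {b : Module.Basis B (Env R A) M}
  {deg : B → ZMod (2 * μ)} {D : SemifreeDGA b deg}

/-- The sequence of objects `X₀, …, Xᵢ, Xᵢ₊ₗ₊₁, Xᵢ₊ₗ₊₂, …`. -/
def skip {Ob : Type*} (X : ℕ → Ob) (i l : ℕ) : ℕ → Ob := fun t => if t ≤ i then X t else X (t + l)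

/-- The weights of the paths that describe `id^{⊠ i} ⊠ ∂_{l+1} ⊠ id^{⊠ r}`, with the signs of the
Leibniz rule. -/
def insertWeight (X : ℕ → Augmentation D) (i l : ℕ) : ℕ → M →ₗ[Env R A] BimodTensor R A M :=
  fun t => if t < i then incMEnv R A M ∘ₗ signM b deg
    else if t = i then augComponent X i (i + (l + 1)) else incMEnv R A M

/-- The Leibniz rule for the differential followed by the augmentations. -/
theorem path_d (X : ℕ → Augmentation D) (n : ℕ) (x : BimodTensor R A M) (a : ℕ) (ha : a < n) :
    path X (fun _ => incMEnv R A M) a n (D.d x) =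
      ∑ i ∈ Finset.Ico a n, ∑ l ∈ Finset.range (n - i),
        path (skip X i l) (insertWeight X i l) a (n - l) x := by
  -- Since $a\le i<n-l$, each path on the right must climb, so elements of $A$ contribute nothing.
  have hne : ∀ i ∈ Finset.Ico a n, ∀ l ∈ Finset.range (n - i), a ≠ n - l := by
    intro i hi l hl
    rw [Finset.mem_Ico] at hi
    rw [Finset.mem_range] at hl
    omega
  induction x using BimodTensor.induction_left generalizing a with
  | add x y hx hy =>
    simp only [map_add, Finset.sum_add_distrib, hx a ha hne, hy a ha hne]
  | incA p =>
    rw [D.d_incA, map_zero]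
    refine (Finset.sum_eq_zero fun i hi => Finset.sum_eq_zero fun l hl => ?_).symm
    rw [path_incA, if_neg (hne i hi l hl)]
  | incA_mul p x hx =>
    rw [D.d_incA_mul, path_incA_mul, hx a ha hne, Finset.mul_sum]
    refine Finset.sum_congr rfl fun i _ => ?_
    rw [Finset.mul_sum]
    exact Finset.sum_congr rfl fun l _ => (path_incA_mul _ _ _ _ _ _).symm
  | incM_mul m x hx =>
    -- The induction hypothesis extended to $a+1=n$, where the right side is empty and the left is
    -- $\varepsilon_n(\partial x)=0$.
    have hsucc : path X (fun _ => incMEnv R A M) (a + 1) n (D.d x) =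
        ∑ i ∈ Finset.Ico (a + 1) n, ∑ l ∈ Finset.range (n - i),
          path (skip X i l) (insertWeight X i l) (a + 1) (n - l) x := by
      rcases (Nat.succ_le_of_lt ha).eq_or_lt with h | h
      · rw [← h, path_self, (X _).map_d, map_zero, Finset.Ico_self, Finset.sum_empty]
      · refine hx (a + 1) h fun i hi l hl => ?_
        rw [Finset.mem_Ico] at hi
        rw [Finset.mem_range] at hl
        omega
    -- The terms with $\partial$ on $m$, sorted by the level reached after reading $\partial m$.
    -- Staying at $a$ gives $\varepsilon_a(\partial m)=0$, so that level is $a+l+1$; the rest of the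
    -- path is renumbered by `skip`.
    have hfirst : path X (fun _ => incMEnv R A M) a n (D.d (incM R A M m) * x) =
        ∑ l ∈ Finset.range (n - a), augComponent X a (a + (l + 1)) m *
          path (skip X a l) (insertWeight X a l) (a + 1) (n - l) x := by
      rw [path_mul, show n + 1 = (a + 1) + (n - a) by omega, Finset.sum_range_add,
        Finset.sum_eq_zero, zero_add]
      · refine Finset.sum_congr rfl fun l hl => ?_
        rw [Finset.mem_range] at hl
        rw [augComponent_apply, show a + 1 + l = a + (l + 1) by omega]
        congr 1
        rw [path_shift (ε := skip X a l) (ε' := X) (r := l) (w' := fun _ => incMEnv R A M),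
          show a + 1 + l = a + (l + 1) by omega, show n - l + l = n by omega]
        · intro j hj
          rw [skip, if_neg (by omega)]
        · intro j hj
          rw [insertWeight, if_neg (by omega), if_neg (by omega)]
      · intro j hj
        rw [Finset.mem_range] at hj
        rcases (Nat.lt_succ_iff.1 hj).eq_or_lt with rfl | h
        · rw [path_self, (X j).map_d, map_zero, zero_mul]
        · rw [path_eq_zero _ _ h, zero_mul]
    rw [D.d_incM_mul, map_add, hfirst, path_incM_mul, Augmentation.map_signM, incMEnv_apply, hsucc,
      hx a ha hne, Finset.sum_eq_sum_Ico_succ_bot ha, Finset.sum_eq_sum_Ico_succ_bot ha, mul_add,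
      Finset.mul_sum, Finset.mul_sum, Finset.mul_sum]
    -- For $i=a$ the step up from $a$ is the inner component; for $i>a$, treated in `h1`, it is $m$
    -- with its sign.
    have h0 : ∀ l, path (skip X a l) (insertWeight X a l) a (n - l) (incM R A M m * x) =
        incA R A M ((X a).toAlgHom (incM R A M m)) *
            path (skip X a l) (insertWeight X a l) a (n - l) x +
          augComponent X a (a + (l + 1)) m *
            path (skip X a l) (insertWeight X a l) (a + 1) (n - l) x := fun l => by
      rw [path_incM_mul]
      congr 2
      · rw [skip, if_pos le_rfl]
      · rw [insertWeight, if_neg (lt_irrefl _), if_pos rfl]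
    have h1 : ∀ i ∈ Finset.Ico (a + 1) n, ∑ l ∈ Finset.range (n - i),
        path (skip X i l) (insertWeight X i l) a (n - l) (incM R A M m * x) =
        incA R A M ((X a).toAlgHom (incM R A M m)) * ∑ l ∈ Finset.range (n - i),
            path (skip X i l) (insertWeight X i l) a (n - l) x +
          incM R A M (signM b deg m) * ∑ l ∈ Finset.range (n - i),
            path (skip X i l) (insertWeight X i l) (a + 1) (n - l) x := fun i hi => by
      rw [Finset.mem_Ico] at hi
      rw [Finset.mul_sum, Finset.mul_sum, ← Finset.sum_add_distrib]
      refine Finset.sum_congr rfl fun l _ => ?_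
      rw [path_incM_mul]
      congr 2
      · rw [skip, if_pos (by omega)]
      · rw [insertWeight, if_pos (by omega)]
        rfl
    rw [Finset.sum_congr rfl fun l _ => h0 l, Finset.sum_congr rfl h1, Finset.sum_add_distrib,
      Finset.sum_add_distrib]
    abel

/-- Weights that have termwise adjoints give adjoint sums over paths. -/
theorem pairing_prod_path (H : HermitianAlgebra R A) (ε : ℕ → Augmentation D)
    {w w' : ℕ → M →ₗ[Env R A] BimodTensor R A M} {u u' : ℕ → BimodTensor R A M} {n : ℕ}
    (h : ∀ a < n, ∀ m, ∃ k : A,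
      (∀ z z', pairing b H (u a * z) (w a m * z') = pairing b H z (incA R A M k * z')) ∧
      ∀ z z', pairing b H (u' a * z) (w' a m * z') = pairing b H z (incA R A M k * z'))
    (x : BimodTensor R A M) (r a : ℕ) (har : a + r = n) (k : A) :
    pairing b H ((List.range' a r).map u).prod (incA R A M k * path ε w a n x) =
      pairing b H ((List.range' a r).map u').prod (incA R A M k * path ε w' a n x) := by
  -- The prefix $k$ must vary: diagonal steps multiply it by augmentation values, and each climb
  -- replaces it by the coefficient from `h`.
  induction x using BimodTensor.induction_left generalizing r a k with
  | add x y hx hy => simp only [map_add, mul_add, hx _ _ har, hy _ _ har]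
  | incA p =>
    rw [path_incA, path_incA]
    rcases r with _ | r
    · simp
    · rw [if_neg (by omega), mul_zero, map_zero, map_zero]
  | incA_mul p x hx =>
    rw [path_incA_mul, path_incA_mul, ← mul_assoc, ← mul_assoc, ← map_mul, hx _ _ har]
  | incM_mul m x hx =>
    rw [path_incM_mul, path_incM_mul, mul_add, mul_add, map_add, map_add, ← mul_assoc,
      ← mul_assoc (incA R A M k) (incA R A M _), ← map_mul, hx _ _ har]
    congr 1
    rcases r with _ | r
    · rw [path_eq_zero _ _ (by omega), path_eq_zero _ _ (by omega)]
      simp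
    · have hk (w : ℕ → M →ₗ[Env R A] BimodTensor R A M) (y : BimodTensor R A M) :
          incA R A M k * (w a m * y) = w a ((k ⊗ₜ[R] op (1 : A)) • m) * y := by
        rw [map_smul, tmul_smul, map_one, mul_one, mul_assoc]
      obtain ⟨k', h1, h2⟩ := h a (by omega) ((k ⊗ₜ[R] op (1 : A)) • m)
      rw [hk, hk, List.range'_succ, List.map_cons, List.map_cons, List.prod_cons, List.prod_cons,
        h1, h2, hx r (a + 1) (by omega)]

end Derivation

/-! ### Bookkeeping for products of inputs. -/

section BoxProd

variable {R A M : Type*} [CommRing R] [Ring A] [Algebra R A] [AddCommGroup M] [Module R M]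
  [Module (Env R A) M]

theorem coe_boxProd (m : ℕ → M) (n : ℕ) :
    (boxProd (R := R) (A := A) m n : BimodTensor R A M) =
      ((List.range' 0 n).map fun j => incM R A M (m j)).prod := by
  rw [← List.range_eq_range', ← List.map_coe_finRange_eq_range, List.map_map]
  exact congrArg List.prod List.ofFn_eq_map

theorem prod_map_range'_add {P : Type*} [Monoid P] (f : ℕ → P) (i s r : ℕ) :
    ((List.range' s r).map fun j => f (i + j)).prod = ((List.range' (i + s) r).map f).prod := by
  rw [← List.map_add_range', List.map_map]
  rfl

theorem prod_map_range'_zero_zsmul {P : Type*} [Ring P] (f : ℕ → P) (c : ℕ → ℤ) (i : ℕ) :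
    ((List.range' 0 i).map fun j => c j • f j).prod =
      (∏ j ∈ Finset.range i, c j) • ((List.range' 0 i).map f).prod := by
  induction i with
  | zero => simp
  | succ i ih =>
    rw [← List.range_eq_range'] at ih ⊢
    rw [List.range_succ, List.map_append, List.map_append, List.prod_append, List.prod_append, ih,
      Finset.prod_range_succ]
    rw [List.map_singleton, List.map_singleton, List.prod_singleton, List.prod_singleton,
      smul_mul_smul_comm]

theorem prod_map_range'_split {P : Type*} [Monoid P] (f : ℕ → P) (s i r : ℕ) :
    ((List.range' s (i + r)).map f).prod =
      ((List.range' s i).map f).prod * ((List.range' (s + i) r).map f).prod := by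
  rw [← List.prod_append, ← List.map_append, List.range'_append_1]

end BoxProd

/-! ### Grading, degrees and the $A_\infty$ relations. -/

section AInfinity

variable {R A M B : Type*} [CommRing R] [Ring A] [Algebra R A] [AddCommGroup M] [Module R M]
  [Module (Env R A) M] {μ : ℕ} [IsScalarTower R (Env R A) M] {b : Module.Basis B (Env R A) M}
  {deg : B → ZMod (2 * μ)} {D : SemifreeDGA b deg}

-- The graded parts are spanned by the blocks of a partition of the basis.
variable (b deg) in
omit [Module R M] [IsScalarTower R (Env R A) M] in
theorem isInternal_gradeDual : DirectSum.IsInternal (gradeDual b deg) := by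
  rcases subsingleton_or_nontrivial (Env R A) with hs | hs
  · have : Subsingleton M := Module.subsingleton (Env R A) M
    rw [DirectSum.isInternal_submodule_iff_iSupIndep_and_iSup_eq_top]
    exact ⟨fun i => disjoint_iff.2 (Subsingleton.elim _ _), Subsingleton.elim _ _⟩
  have hspan : ∀ g, gradeDual b deg g =
      Submodule.span (Env R A) (b '' {c | deg c = g - 1}) := fun g => by
    rw [gradeDual, gradeM]
    congr 1
    ext m
    simp [eq_comm]
  rw [DirectSum.isInternal_submodule_iff_iSupIndep_and_iSup_eq_top]
  constructor
  · intro g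
    simp only [hspan, ← Submodule.span_iUnion, ← Set.image_iUnion]
    refine b.linearIndependent.disjoint_span_image ?_
    rw [Set.disjoint_left]
    intro c hc hc'
    simp only [Set.mem_iUnion, Set.mem_ofPred_eq, exists_prop] at hc hc'
    obtain ⟨g', hg, hg'⟩ := hc'
    exact hg (sub_left_injective (hg'.symm.trans hc))
  · rw [funext hspan, ← Submodule.span_iUnion, ← Set.image_iUnion, eq_top_iff, ← b.span_eq, Submodule.span_le]
    rintro _ ⟨c, rfl⟩
    refine Submodule.subset_span ⟨c, ?_, rfl⟩
    simp only [Set.mem_iUnion, Set.mem_ofPred_eq]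
    exact ⟨deg c + 1, by ring⟩

omit [IsScalarTower R (Env R A) M] [Module R M] in
theorem mem_gradeM_of_repr {g : ZMod (2 * μ)} {m : M} (h : ∀ c, deg c ≠ g → b.repr m c = 0) :
    m ∈ gradeM b deg g := by
  rw [← b.linearCombination_repr m, Finsupp.linearCombination_apply]
  refine Submodule.sum_mem _ fun c _ => ?_
  by_cases hc : deg c = g
  · exact Submodule.smul_mem _ _ (Submodule.subset_span ⟨c, hc, rfl⟩)
  · have : (0 : Env R A) • b c = 0 := zero_smul (Env R A) (b c)
    simp only [h c hc, this]
    exact Submodule.zero_mem _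

theorem augComponent_isHom_length (X : ℕ → Augmentation D) (i l : ℕ) (m : M) :
    IsHom b (fun _ => 1) l (augComponent X i (i + l) m) :=
  path_isHom_length X i l _

theorem IsAdjoint.pairing_augComponent {H : HermitianAlgebra R A} {n : ℕ} {X : ℕ → Augmentation D}
    {ν : boxPow R A M n →ₗ[Env R A] M}
    (h : IsAdjoint b H (deformedComponent fun j : Fin (n + 1) => X j) ν) (w : boxPow R A M n)
    (m : M) : pairing b H w (augComponent X 0 n m) =
      pairing b H (incM R A M (ν w)) (incM R A M m) := by
  rw [← deformedComponent_apply]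
  exact LinearMap.congr_fun (h w) m

theorem IsAdjoint.mem_gradeDual {H : HermitianAlgebra R A} {n : ℕ} {X : ℕ → Augmentation D}
    {ν : boxPow R A M n →ₗ[Env R A] M}
    (h : IsAdjoint b H (deformedComponent fun j : Fin (n + 1) => X j) ν) (m : ℕ → M)
    (g : ℕ → ZMod (2 * μ)) (hm : ∀ j < n, m j ∈ gradeDual b deg (g j)) :
    ν (boxProd m n) ∈ gradeDual b deg (∑ j ∈ Finset.range n, g j + 2 - n) := by
  refine mem_gradeM_of_repr fun c hc => repr_eq_zero_of_pairing b H _ c fun p q => ?_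
  rw [← h.pairing_augComponent, map_smul]
  have hw : IsHom b deg (∑ j ∈ Finset.range n, g j - n)
      (boxProd (R := R) (A := A) m n : BimodTensor R A M) := by
    have := IsHom.prod (b := b) (deg := deg) n (fun j => incM R A M (m j)) (fun j => g j - 1)
      fun j => isHom_of_mem_gradeM (hm j j.2)
    rw [List.sum_ofFn, Finset.sum_sub_distrib, Fin.sum_univ_eq_sum_range] at this
    simp only [Finset.sum_const, Finset.card_univ, Fintype.card_fin, nsmul_eq_mul, mul_one] at this
    exact this
  have hd : IsHom b deg (deg c - 1) (augComponent X 0 n (b c)) :=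
    path_isHom_degree _ _ _ (isHom_of_mem_gradeT (D.d_degree (deg c) _ (Submodule.subset_span
      ⟨1, fun _ => b c, fun _ => deg c, fun _ => Submodule.subset_span ⟨c, rfl, rfl⟩,
        by simp, by simp⟩)))
  refine pairing_eq_zero_of_isHom b H (fun he => hc ?_) hw (hd.smul _)
  -- A nonzero pairing forces $\deg c-1=\sum_j g_j-n$, that is $\deg c=(\sum_j g_j+2-n)-1$, the
  -- unsuspended target degree.
  linear_combination -he

variable (H : HermitianAlgebra R A)
  {ops : ∀ n : ℕ, (Fin (n + 1) → Augmentation D) → (boxPow R A M n →ₗ[Env R A] M)}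

/-- The adjoint of the composition of two deformed components, the first of which is applied
to a factor of the image of the second, is the composition of the adjoints. -/
theorem pairing_path_insertWeight
    (hops : ∀ n : ℕ, 1 ≤ n → ∀ ε : Fin (n + 1) → Augmentation D,
      IsAdjoint b H (deformedComponent ε) (ops n ε))
    (X : ℕ → Augmentation D) (m : ℕ → M) (g : ℕ → ZMod (2 * μ)) (i l r : ℕ)
    (hm : ∀ j < i, m j ∈ gradeDual b deg (g j)) (x : M) :
    pairing b H (boxProd (R := R) (A := A) m (i + (l + 1) + r))
        (path (skip X i l) (insertWeight X i l) 0 (i + 1 + r) (D.d (incM R A M x))) =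
      pairing b H (incM R A M ((-1 : ℤ) ^ ((∑ j ∈ Finset.range i, g j).val + i) •
        ops (i + 1 + r) (fun j => skip X i l j)
          (boxProd (fun j => if j < i then m j else if j = i then
            ops (l + 1) (fun t => X (i + t)) (boxProd (fun t => m (i + t)) (l + 1))
            else m (j + l)) (i + 1 + r)))) (incM R A M x) := by
  -- Here `u` lists the inputs with those of the inner operation grouped as one factor, and `u'` has
  -- that block replaced by the value `v` and the signs `c` inserted before it.
  set v : M := ops (l + 1) (fun t => X (i + t)) (boxProd (fun t => m (i + t)) (l + 1)) with hv
  set m' : ℕ → M := fun j => if j < i then m j else if j = i then v else m (j + l) with hm'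
  set c : ℕ → ℤ := fun j => if j < i then (-1 : ℤ) ^ (g j - 1).val else 1 with hc
  set u : ℕ → BimodTensor R A M := fun j => if j < i then incM R A M (m j) else if j = i then
    (boxProd (R := R) (A := A) (fun t => m (i + t)) (l + 1) : BimodTensor R A M)
    else incM R A M (m (j + l)) with hu
  set u' : ℕ → BimodTensor R A M := fun j => c j • incM R A M (m' j) with hu'
  have hprod : (boxProd (R := R) (A := A) m (i + (l + 1) + r) : BimodTensor R A M) =
      ((List.range' 0 (i + 1 + r)).map u).prod := by
    rw [coe_boxProd, prod_map_range'_split _ 0 (i + (l + 1)), prod_map_range'_split _ 0 i (l + 1),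
      prod_map_range'_split _ 0 (i + 1), prod_map_range'_split _ 0 i 1, List.range'_one,
      List.map_singleton, List.prod_singleton, zero_add, zero_add, zero_add]
    congr 1
    · congr 1
      · refine congrArg _ (List.map_congr_left fun j hj => ?_)
        rw [List.mem_range'_1] at hj
        simp only [hu]
        rw [if_pos (by omega)]
      · simp only [hu]
        rw [if_neg (lt_irrefl _), if_pos trivial, coe_boxProd,
          prod_map_range'_add (fun t => incM R A M (m t)), add_zero]
    · have : ((List.range' (i + 1) r).map u).prod =
          ((List.range' (i + 1) r).map fun j => incM R A M (m (l + j))).prod := by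
        refine congrArg _ (List.map_congr_left fun j hj => ?_)
        rw [List.mem_range'_1] at hj
        simp only [hu]
        rw [if_neg (by omega), if_neg (by omega), add_comm l]
      rw [this, prod_map_range'_add (fun t => incM R A M (m t)),
        show l + (i + 1) = i + (l + 1) by omega]
  have hprod' : ((List.range' 0 (i + 1 + r)).map u').prod =
      (-1 : ℤ) ^ ((∑ j ∈ Finset.range i, g j).val + i) •
        (boxProd (R := R) (A := A) m' (i + 1 + r) : BimodTensor R A M) := by
    rw [hu', prod_map_range'_zero_zsmul, coe_boxProd, ← prod_neg_one_pow_val_sub_one]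
    congr 1
    rw [add_assoc, Finset.prod_range_add, Finset.prod_eq_one (s := Finset.range (1 + r)), mul_one]
    · exact Finset.prod_congr rfl fun j hj => if_pos (Finset.mem_range.1 hj)
    · intro j _
      simp [hc]
  -- Factorwise adjunction: before position $i$ the sign is moved across the pairing, at $i$ the
  -- inner operation is the adjoint of its component, and after $i$ nothing changes.
  have hterm : ∀ a < i + 1 + r, ∀ y, ∃ k : A,
      (∀ z z', pairing b H (u a * z) (insertWeight X i l a y * z') =
        pairing b H z (incA R A M k * z')) ∧
      ∀ z z', pairing b H (u' a * z) (incMEnv R A M y * z') =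
        pairing b H z (incA R A M k * z') := by
    intro a ha y
    rcases lt_trichotomy a i with h | rfl | h
    · obtain ⟨k, hk⟩ := exists_pairing_mul_mul b H (isHom_length_incM b (m a))
        (isHom_length_incM b (signM b deg y))
      have hu1 : u a = incM R A M (m a) := if_pos h
      have hu2 : u' a = incM R A M (signM b deg (m a)) := by
        rw [signM_of_mem_gradeM b deg (hm a h), map_zsmul]
        simp [hu', hc, hm', h]
      refine ⟨H.star k, fun z z' => ?_, fun z z' => ?_⟩
      · rw [hu1, insertWeight, if_pos h, pairing_incA_mul, H.star_star]
        exact hk z z'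
      · rw [hu2, incMEnv_apply, pairing_signM, hk, pairing_incA_mul, H.star_star]
    · have hadj := hops (l + 1) (by omega) (fun t => X (a + t))
      obtain ⟨k, h1, h2⟩ := hadj.exists_pairing b H
        (fun z m => by rw [deformedComponent_shift X, deformedComponent_shift X, map_smul])
        (fun m => by rw [deformedComponent_shift X]; exact augComponent_isHom_length X _ _ _)
        (boxProd (fun t => m (a + t)) (l + 1)) y
      refine ⟨k, fun z z' => ?_, fun z z' => ?_⟩
      · rw [← h2, deformedComponent_shift X, insertWeight, if_neg (lt_irrefl _), if_pos rfl]
        simp [hu]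
      · rw [← h1]
        simp [hu', hc, hm', hv, incMEnv_apply]
    · obtain ⟨k, hk⟩ := exists_pairing_mul_mul b H (isHom_length_incM b (m (a + l)))
        (isHom_length_incM b y)
      have hu1 : u a = incM R A M (m (a + l)) := by
        simp only [hu]
        rw [if_neg (by omega), if_neg (by omega)]
      have hu2 : u' a = incM R A M (m (a + l)) := by
        simp only [hu', hc, hm']
        rw [if_neg (by omega), if_neg (by omega), if_neg (by omega), one_smul]
      refine ⟨H.star k, fun z z' => ?_, fun z z' => ?_⟩
      · rw [hu1, insertWeight, if_neg (by omega), if_neg (by omega), incMEnv_apply, hk,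
          pairing_incA_mul, H.star_star]
      · rw [hu2, incMEnv_apply, hk, pairing_incA_mul, H.star_star]
  have key := pairing_prod_path H (skip X i l) hterm (D.d (incM R A M x)) (i + 1 + r) 0
    (by omega) 1
  rw [map_one, one_mul, one_mul] at key
  rw [hprod, key, hprod', map_zsmul, map_zsmul, map_zsmul, LinearMap.smul_apply,
    LinearMap.smul_apply]
  congr 1
  -- What remains is an ordinary deformed component for the shortened sequence of objects, whose
  -- adjoint is the outer operation.
  exact (hops (i + 1 + r) (by omega) fun j => skip X i l j).pairing_augComponent _ x

/-- The adjoints of the deformed components of a semifree differential graded algebra form an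
`A_∞`-category. -/
theorem isAInfinityCategory_of_isAdjoint
    (hops : ∀ n : ℕ, 1 ≤ n → ∀ ε : Fin (n + 1) → Augmentation D,
      IsAdjoint b H (deformedComponent ε) (ops n ε)) :
    IsAInfinityCategory (gradeDual b deg) (Augmentation D) ops where
  internal := isInternal_gradeDual b deg
  degree n hn X m g hm := (hops n hn fun j => X j).mem_gradeDual m g hm
  relation n hn X m g hm := by
    refine eq_of_pairing b H _ _ fun x => ?_
    rw [map_zero, map_zero, LinearMap.zero_apply]
    -- The Leibniz expansion of $\partial(\partial x)=0$, paired with the inputs.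
    have hd := congrArg (pairing b H (boxProd (R := R) (A := A) m n))
      (path_d X n (D.d (incM R A M x)) 0 (by omega))
    rw [D.d_sq, map_zero, map_zero, map_sum] at hd
    simp only [map_sum] at hd
    rw [Finset.sum_comm' (t' := Finset.range n) (s' := fun l => Finset.range (n - l))
      (by intro i l; simp only [Finset.mem_Ico, Finset.mem_range]; omega)] at hd
    rw [hd, map_sum, map_sum, LinearMap.sum_apply]
    -- The inner arity is $l+1$ and the outer arity $n-l$, so the summation index is the inner arity
    -- minus one.
    refine Finset.sum_nbij' (fun p => p.2 - 1) (fun l => (n - l, l + 1)) ?_ ?_ ?_ ?_ ?_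
    · rintro ⟨k, l⟩ h
      simp only [Finset.mem_filter, Finset.HasAntidiagonal.mem_antidiagonal, Finset.mem_range] at h ⊢
      omega
    · intro l h
      simp only [Finset.mem_filter, Finset.HasAntidiagonal.mem_antidiagonal, Finset.mem_range] at h ⊢
      omega
    · rintro ⟨k, l⟩ h
      simp only [Finset.mem_filter, Finset.HasAntidiagonal.mem_antidiagonal, Prod.mk.injEq] at h ⊢
      omega
    · intro l h
      simp
    · rintro ⟨k, l⟩ h
      simp only [Finset.mem_filter, Finset.HasAntidiagonal.mem_antidiagonal] at h
      obtain ⟨l, rfl⟩ : ∃ l', l = l' + 1 := ⟨l - 1, by omega⟩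
      simp only [Nat.add_sub_cancel]
      rw [map_sum, map_sum, LinearMap.sum_apply, show n - l = k by omega]
      refine Finset.sum_congr rfl fun i hi => ?_
      rw [Finset.mem_range] at hi
      obtain ⟨r, rfl⟩ : ∃ r, k = i + 1 + r := ⟨k - i - 1, by omega⟩
      obtain rfl : n = i + (l + 1) + r := by omega
      exact (pairing_path_insertWeight H hops X m g i l r (fun j hj => hm j (by omega)) x).symm

end AInfinity

end

theorem theorem4p7 {R A M B : Type*} [CommRing R] [Ring A] [Algebra R A] (H : HermitianAlgebra R A)
    [AddCommGroup M] [Module R M] [Module (Env R A) M] [IsScalarTower R (Env R A) M]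
    [Finite B] (b : Module.Basis B (Env R A) M) {μ : ℕ} (deg : B → ZMod (2 * μ))
    (D : SemifreeDGA b deg) :
    (∀ n : ℕ, 1 ≤ n →
      ∃! ν : boxPow R A M n →ₗ[Env R A] M, IsAdjoint b H (D.component n) ν) ∧
    (∀ n : ℕ, 1 ≤ n → ∀ ε : Fin (n + 1) → Augmentation D,
      ∃! ν : boxPow R A M n →ₗ[Env R A] M, IsAdjoint b H (deformedComponent ε) ν) ∧
    (∀ op : ∀ n : ℕ, (Fin (n + 1) → Augmentation D) → (boxPow R A M n →ₗ[Env R A] M),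
      (∀ n : ℕ, 1 ≤ n → ∀ ε : Fin (n + 1) → Augmentation D,
        IsAdjoint b H (deformedComponent ε) (op n ε)) →
      IsAInfinityCategory (gradeDual b deg) (Augmentation D) op) := by
  refine ⟨fun n hn => ?_, fun n hn ε => ?_, fun op hop => isAInfinityCategory_of_isAdjoint H hop⟩
  · refine existsUnique_isAdjoint b H hn _ (fun z m => ?_) (fun m => lengthProj_isHom b n _)
    simp only [SemifreeDGA.component, LinearMap.comp_apply, LinearMap.restrictScalars_apply,
      incM_smul, map_smul, lengthProj_smul]
  · obtain ⟨X, rfl⟩ : ∃ X : ℕ → Augmentation D, (fun t : Fin (n + 1) => X t) = ε :=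
      ⟨fun t => ε (Fin.ofNat (n + 1) t), by ext1 t; simp⟩
    refine existsUnique_isAdjoint b H hn _ (fun z m => ?_) (fun m => ?_)
    · rw [deformedComponent_apply, deformedComponent_apply, map_smul]
    · rw [deformedComponent_apply]
      simpa using augComponent_isHom_length X 0 n m
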